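/- **Model.** Fix $d\ge 1$, $\gamma\in(1,\infty]$, $\tau\in(2,3)$ and $C,w_0>0$. Put $\mu=w_0\frac{\tau-1}{\tau-2}$ and $C_1=(1+(\gamma-1)^{-1})2^d$ (so $C_1=2^d$ if $\gamma=\infty$). For each $n$ let $V=\{1,\dots,n\}$, let $1\le k=k_n\le n$, let $V_C=\{1,\dots,k\}$ (the planted community), and let $(w_i)_{i\in V}=(w_i^{(n)})_{i\in V}$ be deterministic positive weights. Let $F_n(x)=\frac1n\sum_{i\in V}1\{w_i\le x\}$ and $F_k(x)=\frac1k\sum_{i\in V_C}1\{w_i\le x\}$. Assume that, as $n\to\infty$, 1. $1-F_n(x)=Cx^{1-\tau}(1+o(1))$, uniformly over $w_0\le x\le n^{1/(\tau-1)}/\log n$; 2. for every $K>0$, $1-F_k(x)=Cx^{1-\tau}(1+o(1))$, uniformly over $w_0\le x\le K\,k^{1/(\tau-1)}/\log k$; 3. $\max_{i\in V}w_i\le n^{1/(\tau-1)+o(1)}$ and $\max_{i\in V_C}w_i\le k^{1/(\tau-1)+o(1)}$. Let the positions $(x_i)_{i\in V_C}$ be independent and uniform on the torus $(\mathbb R/\mathbb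 Z)^d$, and let $\|\cdot\|$ be the supremum over the coordinates of the distance on the circle $\mathbb R/\mathbb Z$. Given the positions, $G$ is the simple random graph on $V$ in which the edges $\{i,j\}$ are present independently, with probability $$p_{ij}=\frac{1}{1+C_1}\min\Big(\frac{w_iw_j}{\mu k\|x_i-x_j\|^d},1\Big)^{\gamma}\ \text{ if } i,j\in V_C,\qquad p_{ij}=\frac{1}{1+C_1}\min\Big(\frac{w_iw_j}{\mu n},1\Big)\ \text{ otherwise;}$$ for $\gamma=\infty$ the first expression means $\frac1{1+C_1}1\{\|x_i-x_j\|^d\le w_iw_j/(\mu k)\}$. **Theorem.** For $a\in V$ let $$W(a)=\frac{n}{w_a^2}\sum_{b,c\in V}\frac{1}{w_bw_c}\,1\{a,b,c\text{ form a triangle of }G\},\qquad T(a)=1\Big\{W(a)>\frac{n}{w_a\sqrt{\log n}}\Big\},$$ let $\hat V_C=\{a\in V:T(a)=1\}$, and for $U\subseteq V$ and $h>0$ let $U^h=\{a\in U:w_a\ge h\}$. Let $t_n>0$ satisfy $$\Big(\frac{n\log n}{k}\Big)^{1/\tau}\ll t_n\ll k^{1/(\tau-1)},$$ where $f\ll g$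 means $f=o(g)$ as $n\to\infty$. Then, as $n\to\infty$ along those $n$ for which $V_C^{t_n}\neq\emptyset$, $$\mathbb E\left[\frac{|\hat V_C^{t_n}\,\triangle\,V_C^{t_n}|}{2\,|V_C^{t_n}|}\right]\longrightarrow 0 .$$ -/

import Mathlib

open Filter Topology MeasureTheory Asymptotics
open scoped ENNReal

noncomputable section

namespace GeomCommunity

/-- The planted community `V_C` (the type-B vertices): the first `k` of the `n` vertices. -/
def community (n k : ℕ) : Finset (Fin n) := Finset.univ.filter fun i => i.val < k

/-- The empirical weight distribution function of the vertices in `S`: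
`x ↦ |S|⁻¹ ∑_{i ∈ S} 1{w i ≤ x}`. -/
def empCDF {n : ℕ} (S : Finset (Fin n)) (w : Fin n → ℝ) (x : ℝ) : ℝ :=
  ((S.filter fun i => w i ≤ x).card : ℝ) / (S.card : ℝ)

/-- The constant `μ = w₀ (τ - 1) / (τ - 2)`. -/
def meanWeight (τ w₀ : ℝ) : ℝ := w₀ * (τ - 1) / (τ - 2)

/-- The correction constant `C₁ = (1 + (γ - 1)⁻¹) 2 ^ d`; for `γ = ∞` it equals `2 ^ d`. -/
def corrConst (d : ℕ) (γ : ℝ≥0∞) : ℝ := (1 + ((γ - 1)⁻¹).toReal) * 2 ^ d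

/-- The geometric connection profile `min (s / r, 1) ^ γ`, with `s = w_i w_j / (μ k)` and
`r = ‖x_i - x_j‖ ^ d`. It is `1` when `r ≤ s` (in particular when `r = 0 < s`); when `r > s` it is
`(s / r) ^ γ`, which for `γ = ∞` is `0` (the threshold rule). -/
def geomProfile (γ : ℝ≥0∞) (s r : ℝ) : ℝ :=
  if r ≤ s then 1 else if γ = ⊤ then 0 else (s / r) ^ γ.toReal

/-- The probability of the edge `{i, j}` under the alternative hypothesis, given the positions `x`
on the torus `UnitAddTorus (Fin d) = (ℝ / ℤ) ^ d`, whose norm is the supremum over the coordinates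
of the distance on the circle `ℝ / ℤ`. Only the positions of the vertices in the community
matter. -/
def edgeProb (d : ℕ) (τ w₀ : ℝ) (γ : ℝ≥0∞) {n : ℕ} (k : ℕ) (w : Fin n → ℝ)
    (x : Fin n → UnitAddTorus (Fin d)) (i j : Fin n) : ℝ :=
  1 / (1 + corrConst d γ) *
    (if i ∈ community n k ∧ j ∈ community n k then
      geomProfile γ (w i * w j / (meanWeight τ w₀ * k)) (‖x i - x j‖ ^ d)
    else min (w i * w j / (meanWeight τ w₀ * n)) 1)

theorem edgeProb_comm (d : ℕ) (τ w₀ : ℝ) (γ : ℝ≥0∞) {n : ℕ} (k : ℕ) (w : Fin n → ℝ)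
    (x : Fin n → UnitAddTorus (Fin d)) (i j : Fin n) :
    edgeProb d τ w₀ γ k w x i j = edgeProb d τ w₀ γ k w x j i := by
  unfold edgeProb
  simp only [mul_comm (w i) (w j), norm_sub_rev (x i) (x j), and_comm]

/-- The sample space of the alternative model: a position on the torus for every vertex and a
number in `[0, 1]` for every pair of vertices. Its measure `volume` is the product of the uniform
probability measures, so all these coordinates are independent and uniform. -/
abbrev Sample (d n : ℕ) : Type :=
  (Fin n → UnitAddTorus (Fin d)) × (Sym2 (Fin n) → unitInterval)

/-- The random graph of the alternative hypothesis: the edge `{i, j}` is present when the uniform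
variable of the pair is below the edge probability. Hence, given the positions, distinct edges
are independent, and `{i, j}` is present with probability `edgeProb d τ w₀ γ k w x i j`. -/
def randomGraph (d : ℕ) (τ w₀ : ℝ) (γ : ℝ≥0∞) {n : ℕ} (k : ℕ) (w : Fin n → ℝ)
    (ω : Sample d n) : SimpleGraph (Fin n) where
  Adj i j := i ≠ j ∧ (ω.2 s(i, j) : ℝ) < edgeProb d τ w₀ γ k w ω.1 i j
  symm := ⟨fun i j h => ⟨h.1.symm, by
    rw [Sym2.eq_swap, edgeProb_comm]
    exact h.2⟩⟩
  loopless := ⟨fun _ h => h.1 rfl⟩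

open Classical in
/-- The local triangle statistic
`W(a) = n / w_a ^ 2 * ∑_{b, c} 1{a, b, c form a triangle of G} / (w_b w_c)`,
the sum running over all ordered pairs of vertices. -/
def localTriangles {n : ℕ} (w : Fin n → ℝ) (G : SimpleGraph (Fin n)) (a : Fin n) : ℝ :=
  (n : ℝ) / w a ^ 2 *
    ∑ b : Fin n, ∑ c : Fin n, if G.Adj a b ∧ G.Adj b c ∧ G.Adj c a then 1 / (w b * w c) else 0

/-- The estimated community `{a | T(a) = 1}`, where `T(a) = 1{W(a) > n / (w_a √(log n))}`. -/
def estimatedCommunity {n : ℕ} (w : Fin n → ℝ) (G : SimpleGraph (Fin n)) : Finset (Fin n) :=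
  Finset.univ.filter fun a =>
    localTriangles w G a > (n : ℝ) / (w a * Real.sqrt (Real.log n))

/-- The set `U ^ h` of the vertices of `U` with weight at least `h`. -/
def heavy {n : ℕ} (w : Fin n → ℝ) (U : Finset (Fin n)) (h : ℝ) : Finset (Fin n) :=
  U.filter fun a => w a ≥ h

/-- The expected normalized symmetric difference, under the alternative hypothesis, between the
estimated community and the community, both restricted to the vertices of weight at least `t`. -/
def risk (d : ℕ) (τ w₀ : ℝ) (γ : ℝ≥0∞) {n : ℕ} (k : ℕ) (w : Fin n → ℝ) (t : ℝ) : ℝ :=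
  ∫ ω : Sample d n,
    ((symmDiff (heavy w (estimatedCommunity w (randomGraph d τ w₀ γ k w ω)) t)
        (heavy w (community n k) t)).card : ℝ) /
      (2 * ((heavy w (community n k) t).card : ℝ))

end GeomCommunity

end

/-! By linearity the risk is the sum, over the vertices of weight at least `t`, of the probability
of being misclassified, divided by twice the number of such vertices in the community. Two estimates
bound it.

A vertex `a` outside the community has few triangles. Both of its edges have probability at most
`w_i w_j / (μ n)` whatever the positions, and the opposite edge `{b, c}`, averaged over positions,
has probability `O(w_b w_c / k)` inside the community and `O(w_b w_c / n)` otherwise. The factor `1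
/ (w_b w_c)` cancels the weights of the first two edges, and the first moments of the weights make
`W(a)` of bounded mean. Markov's inequality gives error probability `O(w_a √(log n) / n)`
(`volume_mem_estimatedCommunity_le`).

A heavy vertex `a` inside the community has many triangles. Take `b` near `a` and `c` near `b`, both
of weight in `(w₀, 2 w₀]`. The triangle inequality brings `c` near `a`, and all three edges then
have the constant retention probability. The number of such triangles has mean of order `w_a` and
variance `O(w_a)`, since only pairs of triangles sharing `b` or `c` are correlated. Thus `W(a)` is
of order at least `n / w_a`, above the threshold, except with probability `O(1 / w_a)` by Chebyshev
(`volume_notMem_estimatedCommunity_le`).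

The missed vertices contribute `O(1 / t)`. For the false reports, the window for `t` forces `n ≤ k ^
3`, so `log n` and `log k` are comparable. If `t ≤ k ^ (1/(τ-1)) / log k`, the community has at
least order `log n` heavy vertices against `O(√(log n))` expected false reports. If `t` is larger, a
moment of order `1 + δ` cuts the weight sum by a factor `log n`, and one heavy vertex suffices
(`eventually_sum_outside_le`). -/

namespace GeomCommunity

/-! ### Uniform positions on the torus and independence -/

section Positions

instance : IsProbabilityMeasure (volume : Measure UnitAddCircle) :=
  ⟨by simp [AddCircle.measure_univ]⟩

instance (d : ℕ) : IsProbabilityMeasure (volume : Measure (UnitAddTorus (Fin d))) :=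
  inferInstanceAs (IsProbabilityMeasure (Measure.pi fun _ : Fin d => volume))

instance (d n : ℕ) : IsProbabilityMeasure (volume : Measure (Fin n → UnitAddTorus (Fin d))) :=
  inferInstanceAs (IsProbabilityMeasure (Measure.pi fun _ : Fin n => volume))

instance (n : ℕ) : IsProbabilityMeasure (volume : Measure (Sym2 (Fin n) → unitInterval)) :=
  inferInstanceAs (IsProbabilityMeasure (Measure.pi fun _ : Sym2 (Fin n) => volume))

instance (d n : ℕ) : IsProbabilityMeasure (volume : Measure (Sample d n)) :=
  inferInstanceAs (IsProbabilityMeasure (Measure.prod volume volume))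

/-- Resampling one coordinate leaves a product probability measure unchanged. Independence of the
positions is used in this form. -/
theorem lintegral_update {ι : Type*} [Fintype ι] [DecidableEq ι] {X : ι → Type*}
    [∀ i, MeasurableSpace (X i)] (μ : ∀ i, Measure (X i)) [∀ i, IsProbabilityMeasure (μ i)]
    (i : ι) {f : (∀ i, X i) → ℝ≥0∞} (hf : Measurable f) :
    ∫⁻ x, f x ∂Measure.pi μ = ∫⁻ x, ∫⁻ y, f (Function.update x i y) ∂μ i ∂Measure.pi μ := by
  have h := lmarginal_singleton (μ := μ) f i
  rw [← h]
  refine lintegral_eq_of_lmarginal_eq {i} hf (hf.lmarginal μ) ?_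
  rw [lmarginal_singleton (μ := μ) (∫⋯∫⁻_{i}, f ∂μ) i]
  funext x
  simp [lmarginal_update_of_mem]

theorem volume_closedBall_torus {d : ℕ} (z : UnitAddTorus (Fin d)) {s : ℝ} (hs : 0 ≤ s) :
    volume (Metric.closedBall z s) = ENNReal.ofReal (min 1 (2 * s)) ^ d := by
  rw [MeasureTheory.volume_pi_closedBall z hs]
  simp [AddCircle.volume_closedBall]

/-- The volume of the ball `{y | ‖y‖ ^ d ≤ v}` of the torus. -/
noncomputable def ballVol (d : ℕ) (v : ℝ) : ℝ≥0∞ :=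
  volume {y : UnitAddTorus (Fin d) | ‖y‖ ^ d ≤ v}

/-- Balls of the supremum norm are cubes of side `2 v ^ (1/d)`, capped at the whole circle. Taking
`v = s / 2 ^ d` with `s ≤ 1` gives volume exactly `s`. -/
theorem ballVol_eq {d : ℕ} (hd : 1 ≤ d) {v : ℝ} (hv : 0 ≤ v) :
    ballVol d v = ENNReal.ofReal (min 1 (2 ^ d * v)) := by
  have hd0 : d ≠ 0 := by omega
  have hs : 0 ≤ v ^ ((d : ℝ)⁻¹) := by positivity
  have hpow : (v ^ ((d : ℝ)⁻¹)) ^ d = v := Real.rpow_inv_natCast_pow hv hd0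
  have : {y : UnitAddTorus (Fin d) | ‖y‖ ^ d ≤ v} = Metric.closedBall 0 (v ^ ((d : ℝ)⁻¹)) := by
    ext y
    simp only [Set.mem_ofPred_eq, Metric.mem_closedBall, dist_zero_right]
    nth_rewrite 1 [← hpow]
    exact pow_le_pow_iff_left₀ (norm_nonneg _) hs hd0
  rw [ballVol, this, volume_closedBall_torus _ hs, ← ENNReal.ofReal_pow (by positivity)]
  congr 1
  rcases le_total 1 (2 * v ^ ((d : ℝ)⁻¹)) with h | h
  · rw [min_eq_left h, one_pow, min_eq_left]
    rw [← hpow, ← mul_pow]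
    exact one_le_pow₀ h
  · rw [min_eq_right h, mul_pow, hpow, min_eq_right]
    rw [← hpow, ← mul_pow]
    exact pow_le_one₀ (by positivity) h

theorem ballVol_le {d : ℕ} (hd : 1 ≤ d) {v : ℝ} (hv : 0 ≤ v) :
    ballVol d v ≤ ENNReal.ofReal (2 ^ d * v) := by
  rw [ballVol_eq hd hv]
  exact ENNReal.ofReal_le_ofReal (min_le_right _ _)

theorem measurable_norm_pow (d : ℕ) : Measurable fun y : UnitAddTorus (Fin d) => ‖y‖ ^ d :=
  (continuous_norm.pow d).measurable

theorem lintegral_sub_torus {d : ℕ} (f : UnitAddTorus (Fin d) → ℝ≥0∞)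
    (z : UnitAddTorus (Fin d)) : ∫⁻ y, f (y - z) = ∫⁻ y, f y := by
  have : (volume : Measure (UnitAddTorus (Fin d))).IsAddHaarMeasure :=
    inferInstanceAs (Measure.pi fun _ : Fin d => (volume : Measure UnitAddCircle)).IsAddHaarMeasure
  exact lintegral_sub_right_eq_self f z

theorem measurable_sub_norm_pow {d n : ℕ} (i j : Fin n) :
    Measurable fun x : Fin n → UnitAddTorus (Fin d) => ‖x i - x j‖ ^ d := by
  refine Continuous.measurable ?_
  fun_prop

/-- With all positions but `x i` fixed, translation invariance makes `x i - x j` uniform, and `f`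
does not see `x i`. -/
theorem lintegral_pair_sub {d n : ℕ} {i j : Fin n} (hij : i ≠ j) {g : UnitAddTorus (Fin d) → ℝ≥0∞}
    (hg : Measurable g) {f : (Fin n → UnitAddTorus (Fin d)) → ℝ≥0∞} (hf : Measurable f)
    (hinv : ∀ x y, f (Function.update x i y) = f x) :
    ∫⁻ x : Fin n → UnitAddTorus (Fin d), f x * g (x i - x j) = (∫⁻ x, f x) * ∫⁻ y, g y := by
  have hsub : Measurable fun x : Fin n → UnitAddTorus (Fin d) => x i - x j :=
    Continuous.measurable (by fun_prop)
  have := lintegral_update (fun _ : Fin n => (volume : Measure (UnitAddTorus (Fin d)))) i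
    (hf.mul (hg.comp hsub))
  simp only [Pi.mul_apply, Function.comp_def, Function.update_self, hinv,
    Function.update_of_ne hij.symm] at this
  rw [volume_pi, this, ← lintegral_mul_const _ hf]
  congr 1
  funext x
  have hm : Measurable fun y => g (y - x j) := hg.comp (measurable_id.sub_const _)
  rw [lintegral_const_mul _ hm, lintegral_sub_torus]

/-- An event not involving `x i` is independent of the closeness of `i` to `j`. Iterated, this
factors any family of closeness conditions that forms a forest, attaching one leaf at a time. -/
theorem volume_inter_near {d n : ℕ} {i j : Fin n} (hij : i ≠ j) (v : ℝ)
    {A : Set (Fin n → UnitAddTorus (Fin d))} (hA : MeasurableSet A)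
    (hinv : ∀ x y, Function.update x i y ∈ A ↔ x ∈ A) :
    volume (A ∩ {x | ‖x i - x j‖ ^ d ≤ v}) = volume A * ballVol d v := by
  have hm : MeasurableSet {y : UnitAddTorus (Fin d) | ‖y‖ ^ d ≤ v} :=
    measurableSet_le (measurable_norm_pow d) measurable_const
  have h := lintegral_pair_sub hij (g := Set.indicator {y | ‖y‖ ^ d ≤ v} 1)
    (measurable_one.indicator hm) (f := A.indicator 1) (measurable_one.indicator hA)
    (fun x y => by by_cases hx : x ∈ A <;> simp [Set.indicator, hinv, hx])
  rw [lintegral_indicator_one hA, lintegral_indicator_one hm] at h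
  rw [ballVol, ← h, ← lintegral_indicator_one
    (hA.inter (measurableSet_le (measurable_sub_norm_pow i j) measurable_const))]
  congr 1
  funext x
  by_cases hx : x ∈ A <;> by_cases hy : ‖x i - x j‖ ^ d ≤ v <;> simp [Set.indicator, hx, hy]

theorem volume_near {d n : ℕ} {i j : Fin n} (hij : i ≠ j) (v : ℝ) :
    volume {x : Fin n → UnitAddTorus (Fin d) | ‖x i - x j‖ ^ d ≤ v} = ballVol d v := by
  simpa using volume_inter_near (d := d) hij v MeasurableSet.univ (by simp)

theorem volume_uniforms {n : ℕ} (S : Finset (Sym2 (Fin n))) (p : Sym2 (Fin n) → ℝ)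
    (h0 : ∀ e ∈ S, 0 ≤ p e) (h1 : ∀ e ∈ S, p e ≤ 1) :
    volume {u : Sym2 (Fin n) → unitInterval | ∀ e ∈ S, (u e : ℝ) < p e}
      = ∏ e ∈ S, ENNReal.ofReal (p e) := by
  classical
  have : {u : Sym2 (Fin n) → unitInterval | ∀ e ∈ S, (u e : ℝ) < p e}
      = Set.univ.pi fun e => if e ∈ S then {v : unitInterval | (v : ℝ) < p e} else Set.univ := by
    ext u
    simp only [Set.mem_ofPred_eq, Set.mem_pi, Set.mem_univ, forall_const]
    refine forall_congr' fun e => ?_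
    by_cases he : e ∈ S <;> simp [he]
  rw [this, volume_pi, Measure.pi_pi, ← Finset.prod_subset (Finset.subset_univ S)]
  · refine Finset.prod_congr rfl fun e he => ?_
    rw [if_pos he]
    exact unitInterval.volume_Iio ⟨p e, h0 e he, h1 e he⟩
  · intro e _ he
    rw [if_neg he]
    exact measure_univ

end Positions

/-! ### Edge and triangle probabilities -/

section EdgeProbabilities

/-- The retention probability `1 / (1 + C₁)`. -/
noncomputable def retention (d : ℕ) (γ : ℝ≥0∞) : ℝ := 1 / (1 + corrConst d γ)

theorem corrConst_nonneg (d : ℕ) (γ : ℝ≥0∞) : 0 ≤ corrConst d γ := by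
  unfold corrConst
  positivity

theorem retention_pos (d : ℕ) (γ : ℝ≥0∞) : 0 < retention d γ := by
  have := corrConst_nonneg d γ
  unfold retention
  positivity

theorem retention_le_one (d : ℕ) (γ : ℝ≥0∞) : retention d γ ≤ 1 := by
  have := corrConst_nonneg d γ
  unfold retention
  rw [div_le_one (by linarith)]
  linarith

theorem meanWeight_pos {τ w₀ : ℝ} (hτ : 2 < τ) (hw₀ : 0 < w₀) : 0 < meanWeight τ w₀ := by
  unfold meanWeight
  have : 0 < τ - 1 := by linarith
  have : 0 < τ - 2 := by linarith
  positivity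

theorem geomProfile_nonneg (γ : ℝ≥0∞) {s r : ℝ} (hs : 0 ≤ s) (hr : 0 ≤ r) :
    0 ≤ geomProfile γ s r := by
  unfold geomProfile
  split_ifs <;> positivity

theorem geomProfile_le_one (γ : ℝ≥0∞) {s r : ℝ} (hs : 0 ≤ s) (hr : 0 ≤ r) :
    geomProfile γ s r ≤ 1 := by
  unfold geomProfile
  split_ifs with h1 h2
  · exact le_rfl
  · exact zero_le_one
  · push Not at h1
    exact Real.rpow_le_one (by positivity) ((div_le_one (by linarith)).2 h1.le) (by positivity)

theorem geomProfile_of_le (γ : ℝ≥0∞) {s r : ℝ} (h : r ≤ s) : geomProfile γ s r = 1 := if_pos h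

theorem measurable_geomProfile (γ : ℝ≥0∞) (s : ℝ) : Measurable (geomProfile γ s) := by
  unfold geomProfile
  refine Measurable.ite (measurableSet_le measurable_id measurable_const) measurable_const ?_
  split_ifs
  · exact measurable_const
  · exact (measurable_const.div measurable_id).pow_const _

theorem edgeProb_nonneg {d : ℕ} {τ w₀ : ℝ} (hτ : 2 < τ) (hw₀ : 0 < w₀) (γ : ℝ≥0∞) {n : ℕ} (k : ℕ)
    {w : Fin n → ℝ} (hw : ∀ i, 0 < w i) (x : Fin n → UnitAddTorus (Fin d)) (i j : Fin n) :
    0 ≤ edgeProb d τ w₀ γ k w x i j := by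
  have hμ := meanWeight_pos hτ hw₀
  have := hw i
  have := hw j
  refine mul_nonneg (retention_pos d γ).le ?_
  split_ifs
  · exact geomProfile_nonneg γ (by positivity) (by positivity)
  · positivity

theorem edgeProb_le_one {d : ℕ} {τ w₀ : ℝ} (hτ : 2 < τ) (hw₀ : 0 < w₀) (γ : ℝ≥0∞) {n : ℕ} (k : ℕ)
    {w : Fin n → ℝ} (hw : ∀ i, 0 < w i) (x : Fin n → UnitAddTorus (Fin d)) (i j : Fin n) :
    edgeProb d τ w₀ γ k w x i j ≤ 1 := by
  have hμ := meanWeight_pos hτ hw₀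
  have := hw i
  have := hw j
  refine mul_le_one₀ (retention_le_one d γ) ?_ ?_
  · split_ifs
    · exact geomProfile_nonneg γ (by positivity) (by positivity)
    · positivity
  · split_ifs
    · exact geomProfile_le_one γ (by positivity) (by positivity)
    · exact min_le_right _ _

theorem edgeProb_le_of_notMem {d : ℕ} {τ w₀ : ℝ} (hτ : 2 < τ) (hw₀ : 0 < w₀) (γ : ℝ≥0∞) {n : ℕ}
    {k : ℕ} {w : Fin n → ℝ} (hw : ∀ i, 0 < w i) (x : Fin n → UnitAddTorus (Fin d)) {i j : Fin n}
    (h : ¬ (i ∈ community n k ∧ j ∈ community n k)) :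
    edgeProb d τ w₀ γ k w x i j ≤ w i * w j / (meanWeight τ w₀ * n) := by
  have hμ := meanWeight_pos hτ hw₀
  have := hw i
  have := hw j
  unfold edgeProb
  rw [if_neg h]
  calc _ ≤ 1 * min (w i * w j / (meanWeight τ w₀ * n)) 1 :=
        mul_le_mul_of_nonneg_right (retention_le_one d γ) (by positivity)
    _ ≤ _ := by rw [one_mul]; exact min_le_left _ _

theorem measurable_edgeProb (d : ℕ) (τ w₀ : ℝ) (γ : ℝ≥0∞) {n : ℕ} (k : ℕ) (w : Fin n → ℝ)
    (i j : Fin n) :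
    Measurable fun x : Fin n → UnitAddTorus (Fin d) => edgeProb d τ w₀ γ k w x i j := by
  unfold edgeProb
  refine Measurable.const_mul ?_ _
  split_ifs
  · exact (measurable_geomProfile γ _).comp (measurable_sub_norm_pow i j)
  · exact measurable_const

theorem measurableSet_adj (d : ℕ) (τ w₀ : ℝ) (γ : ℝ≥0∞) {n : ℕ} (k : ℕ) (w : Fin n → ℝ)
    (i j : Fin n) : MeasurableSet {ω : Sample d n | (randomGraph d τ w₀ γ k w ω).Adj i j} := by
  refine MeasurableSet.inter (MeasurableSet.const _) ?_
  refine measurableSet_lt ?_ ((measurable_edgeProb d τ w₀ γ k w i j).comp measurable_fst)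
  exact measurable_subtype_coe.comp ((measurable_pi_apply _).comp measurable_snd)

theorem measurableSet_triangle (d : ℕ) (τ w₀ : ℝ) (γ : ℝ≥0∞) {n : ℕ} (k : ℕ) (w : Fin n → ℝ)
    (a b c : Fin n) : MeasurableSet {ω : Sample d n | (randomGraph d τ w₀ γ k w ω).Adj a b ∧
      (randomGraph d τ w₀ γ k w ω).Adj b c ∧ (randomGraph d τ w₀ γ k w ω).Adj c a} :=
  (measurableSet_adj d τ w₀ γ k w a b).inter
    ((measurableSet_adj d τ w₀ γ k w b c).inter (measurableSet_adj d τ w₀ γ k w c a))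

theorem inv_toReal_lt_one {γ : ℝ≥0∞} (hγ : 1 < γ) : γ.toReal⁻¹ < 1 := by
  rcases eq_or_ne γ ⊤ with rfl | h
  · simp
  · have : 1 < γ.toReal := by
      rw [← ENNReal.toReal_one]
      exact (ENNReal.toReal_lt_toReal ENNReal.one_ne_top h).2 hγ
    exact inv_lt_one_of_one_lt₀ this

/-- Inverting `(s / r) ^ γ > u` bounds `r`. For `γ = ⊤` the conventions `⊤.toReal = 0` and `0⁻¹ = 0`
turn the bound into `r ≤ s`, the threshold rule. -/
theorem le_of_lt_geomProfile {γ : ℝ≥0∞} (hγ : 1 < γ) {s r u : ℝ} (hs : 0 < s) (hu : 0 < u)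
    (h : u < geomProfile γ s r) : r ≤ s * u ^ (-γ.toReal⁻¹) := by
  unfold geomProfile at h
  split_ifs at h with h1 h2
  · refine h1.trans (le_mul_of_one_le_right hs.le ?_)
    exact Real.one_le_rpow_of_pos_of_le_one_of_nonpos hu h.le (by simp)
  · linarith
  · push Not at h1
    have hr : 0 < r := hs.trans h1
    have hg : 0 < γ.toReal := ENNReal.toReal_pos (by positivity) h2
    have h3 : u ^ γ.toReal⁻¹ < s / r := by
      have := Real.rpow_lt_rpow hu.le h (inv_pos.2 hg)
      rwa [Real.rpow_rpow_inv (by positivity) hg.ne'] at this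
    rw [Real.rpow_neg hu.le, ← div_eq_mul_inv, le_div_iff₀ (by positivity)]
    rw [lt_div_iff₀ hr] at h3
    linarith

/-- The constant in the bound `∫ min (s / ‖y‖ ^ d, 1) ^ γ dy ≤ profileConst d γ * s`. -/
noncomputable def profileConst (d : ℕ) (γ : ℝ≥0∞) : ℝ := 2 ^ d / (1 - γ.toReal⁻¹)

theorem profileConst_nonneg (d : ℕ) {γ : ℝ≥0∞} (hγ : 1 < γ) : 0 ≤ profileConst d γ := by
  have := inv_toReal_lt_one hγ
  unfold profileConst
  exact div_nonneg (by positivity) (by linarith)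

/-- Layer cake: the superlevel set at height `u ≤ 1` lies in a ball of volume at most `2 ^ d s u ^
(-1/γ)`, which is integrable on `(0, 1]` because `γ > 1`. -/
theorem lintegral_geomProfile_le {d : ℕ} (hd : 1 ≤ d) {γ : ℝ≥0∞} (hγ : 1 < γ) {s : ℝ}
    (hs : 0 < s) :
    ∫⁻ y : UnitAddTorus (Fin d), ENNReal.ofReal (geomProfile γ s (‖y‖ ^ d))
      ≤ ENNReal.ofReal (profileConst d γ * s) := by
  have hg := inv_toReal_lt_one hγ
  set e := γ.toReal⁻¹ with he
  rw [lintegral_eq_lintegral_meas_lt volume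
    (Filter.Eventually.of_forall fun y => geomProfile_nonneg γ hs.le (by positivity))
    ((measurable_geomProfile γ s).comp (measurable_norm_pow d)).aemeasurable]
  have hle : ∀ u ∈ Set.Ioi (0 : ℝ),
      volume {y : UnitAddTorus (Fin d) | u < geomProfile γ s (‖y‖ ^ d)} ≤
        (Set.Ioc (0 : ℝ) 1).indicator (fun u => ENNReal.ofReal (2 ^ d * s * u ^ (-e))) u := by
    intro u hu
    rcases le_or_gt u 1 with h1 | h1
    · rw [Set.indicator_of_mem (show u ∈ Set.Ioc 0 1 from ⟨hu, h1⟩), mul_assoc]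
      refine le_trans (measure_mono fun y hy => ?_)
        (ballVol_le hd (v := s * u ^ (-e)) (mul_nonneg hs.le (Real.rpow_nonneg hu.le _)))
      exact le_of_lt_geomProfile hγ hs hu hy
    · have : {y : UnitAddTorus (Fin d) | u < geomProfile γ s (‖y‖ ^ d)} = ∅ := by
        ext y
        simpa using (geomProfile_le_one γ hs.le (by positivity)).trans h1.le
      rw [this, measure_empty]
      exact zero_le
  refine (setLIntegral_mono' measurableSet_Ioi hle).trans ?_
  rw [lintegral_indicator measurableSet_Ioc, Measure.restrict_restrict measurableSet_Ioc,
    Set.inter_eq_left.2 (fun u hu => hu.1)]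
  have hint : IntervalIntegrable (fun u : ℝ => u ^ (-e)) volume 0 1 :=
    intervalIntegral.intervalIntegrable_rpow' (by linarith)
  have hint2 : IntegrableOn (fun u : ℝ => 2 ^ d * s * u ^ (-e)) (Set.Ioc 0 1) :=
    ((intervalIntegrable_iff_integrableOn_Ioc_of_le zero_le_one).1 hint).const_mul _
  rw [← ofReal_integral_eq_lintegral_ofReal hint2]
  · refine ENNReal.ofReal_le_ofReal (le_of_eq ?_)
    rw [integral_const_mul, ← intervalIntegral.integral_of_le zero_le_one,
      integral_rpow (Or.inl (by linarith))]
    have h1 : -e + 1 ≠ 0 := by linarith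
    have h2 : 1 - e ≠ 0 := by linarith
    rw [Real.one_rpow, Real.zero_rpow h1]
    unfold profileConst
    rw [← he]
    field_simp
    ring
  · refine (ae_restrict_iff' measurableSet_Ioc).2 (Filter.Eventually.of_forall fun u hu => ?_)
    have := Real.rpow_nonneg hu.1.le (-e)
    positivity

theorem lintegral_edgeProb_le {d : ℕ} (hd : 1 ≤ d) {γ : ℝ≥0∞} (hγ : 1 < γ) {τ w₀ : ℝ} (hτ : 2 < τ)
    (hw₀ : 0 < w₀) {n k : ℕ} (hk : 1 ≤ k) {w : Fin n → ℝ} (hw : ∀ i, 0 < w i) {i j : Fin n}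
    (hij : i ≠ j) :
    ∫⁻ x : Fin n → UnitAddTorus (Fin d), ENNReal.ofReal (edgeProb d τ w₀ γ k w x i j) ≤
      ENNReal.ofReal ((if i ∈ community n k ∧ j ∈ community n k then
        profileConst d γ * (w i * w j / (meanWeight τ w₀ * k)) else 0) +
        w i * w j / (meanWeight τ w₀ * n)) := by
  have hμ := meanWeight_pos hτ hw₀
  have hi := hw i
  have hj := hw j
  have hk' : (0 : ℝ) < k := by exact_mod_cast hk
  by_cases h : i ∈ community n k ∧ j ∈ community n k
  · rw [if_pos h]
    have h1 : ∫⁻ x : Fin n → UnitAddTorus (Fin d),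
        ENNReal.ofReal (geomProfile γ (w i * w j / (meanWeight τ w₀ * k)) (‖x i - x j‖ ^ d)) =
        ∫⁻ y : UnitAddTorus (Fin d),
          ENNReal.ofReal (geomProfile γ (w i * w j / (meanWeight τ w₀ * k)) (‖y‖ ^ d)) := by
      simpa using lintegral_pair_sub hij (f := fun _ => 1)
        (((measurable_geomProfile γ (w i * w j / (meanWeight τ w₀ * k))).comp
          (measurable_norm_pow d)).ennreal_ofReal) measurable_const (by simp)
    have h2 := lintegral_geomProfile_le hd hγ (s := w i * w j / (meanWeight τ w₀ * k))
      (by positivity)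
    rw [← h1] at h2
    refine le_trans (lintegral_mono fun x => ENNReal.ofReal_le_ofReal ?_)
      (h2.trans (ENNReal.ofReal_le_ofReal (le_add_of_nonneg_right (by positivity))))
    unfold edgeProb
    rw [if_pos h]
    exact mul_le_of_le_one_left (geomProfile_nonneg γ (by positivity) (by positivity))
      (retention_le_one d γ)
  · rw [if_neg h, zero_add]
    refine (lintegral_mono fun x => ENNReal.ofReal_le_ofReal
      (edgeProb_le_of_notMem hτ hw₀ γ hw x h)).trans ?_
    simp

theorem volume_triangle {d : ℕ} {τ w₀ : ℝ} (hτ : 2 < τ) (hw₀ : 0 < w₀) (γ : ℝ≥0∞) {n : ℕ} (k : ℕ)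
    {w : Fin n → ℝ} (hw : ∀ i, 0 < w i) {a b c : Fin n} (hab : a ≠ b) (hbc : b ≠ c) (hca : c ≠ a) :
    volume {ω : Sample d n | (randomGraph d τ w₀ γ k w ω).Adj a b ∧
      (randomGraph d τ w₀ γ k w ω).Adj b c ∧ (randomGraph d τ w₀ γ k w ω).Adj c a} =
    ∫⁻ x : Fin n → UnitAddTorus (Fin d), ENNReal.ofReal (edgeProb d τ w₀ γ k w x a b) *
      ENNReal.ofReal (edgeProb d τ w₀ γ k w x b c) *
      ENNReal.ofReal (edgeProb d τ w₀ γ k w x c a) := by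
  rw [Measure.volume_eq_prod, Measure.prod_apply (measurableSet_triangle d τ w₀ γ k w a b c)]
  refine lintegral_congr fun x => ?_
  let p : Sym2 (Fin n) → ℝ :=
    Sym2.lift ⟨fun i j => edgeProb d τ w₀ γ k w x i j, edgeProb_comm d τ w₀ γ k w x⟩
  have h0 : ∀ e, 0 ≤ p e := fun e => by
    induction e with | _ i j => exact edgeProb_nonneg hτ hw₀ γ k hw x i j
  have h1 : ∀ e, p e ≤ 1 := fun e => by
    induction e with | _ i j => exact edgeProb_le_one hτ hw₀ γ k hw x i j
  have := volume_uniforms {s(a, b), s(b, c), s(c, a)} p (fun e _ => h0 e) fun e _ => h1 e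
  have n1 : s(a, b) ∉ ({s(b, c), s(c, a)} : Finset (Sym2 (Fin n))) := by
    simp [hab, hbc, hab.symm, hca.symm]
  have n2 : s(b, c) ∉ ({s(c, a)} : Finset (Sym2 (Fin n))) := by
    simp [hbc, hca, hab.symm]
  rw [Finset.prod_insert n1, Finset.prod_insert n2, Finset.prod_singleton, ← mul_assoc] at this
  refine Eq.trans (congrArg _ ?_) this
  ext u
  simp [randomGraph, hab, hbc, hca, p]

/-- The two edges at `a ∉ V_C` are bounded uniformly in the positions, so only the edge `{b, c}` has
to be averaged. Degenerate triples have probability zero. -/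
theorem volume_triangle_le {d : ℕ} (hd : 1 ≤ d) {γ : ℝ≥0∞} (hγ : 1 < γ) {τ w₀ : ℝ} (hτ : 2 < τ)
    (hw₀ : 0 < w₀) {n k : ℕ} (hk : 1 ≤ k) {w : Fin n → ℝ} (hw : ∀ i, 0 < w i) {a : Fin n}
    (ha : a ∉ community n k) (b c : Fin n) :
    volume {ω : Sample d n | (randomGraph d τ w₀ γ k w ω).Adj a b ∧
      (randomGraph d τ w₀ γ k w ω).Adj b c ∧ (randomGraph d τ w₀ γ k w ω).Adj c a} ≤
    ENNReal.ofReal (w a * w b / (meanWeight τ w₀ * n) * (w c * w a / (meanWeight τ w₀ * n)) *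
      ((if b ∈ community n k ∧ c ∈ community n k then
        profileConst d γ * (w b * w c / (meanWeight τ w₀ * k)) else 0) +
        w b * w c / (meanWeight τ w₀ * n))) := by
  by_cases h : a ≠ b ∧ b ≠ c ∧ c ≠ a
  · obtain ⟨hab, hbc, hca⟩ := h
    have hμ := meanWeight_pos hτ hw₀
    have := hw a
    have := hw b
    have := hw c
    rw [volume_triangle hτ hw₀ γ k hw hab hbc hca, ENNReal.ofReal_mul (by positivity),
      ENNReal.ofReal_mul (by positivity)]
    refine le_trans (lintegral_mono (g := fun x => ENNReal.ofReal (w a * w b /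
      (meanWeight τ w₀ * n)) * ENNReal.ofReal (w c * w a / (meanWeight τ w₀ * n)) *
      ENNReal.ofReal (edgeProb d τ w₀ γ k w x b c)) fun x => ?_) ?_
    · change _ ≤ ENNReal.ofReal (w a * w b /
        (meanWeight τ w₀ * n)) * ENNReal.ofReal (w c * w a / (meanWeight τ w₀ * n)) *
        ENNReal.ofReal (edgeProb d τ w₀ γ k w x b c)
      rw [mul_right_comm]
      gcongr
      · exact edgeProb_le_of_notMem hτ hw₀ γ hw x fun h => ha h.1
      · exact edgeProb_le_of_notMem hτ hw₀ γ hw x fun h => ha h.2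
    · rw [lintegral_const_mul _ (measurable_edgeProb d τ w₀ γ k w b c).ennreal_ofReal]
      gcongr
      exact lintegral_edgeProb_le hd hγ hτ hw₀ hk hw hbc
  · have : {ω : Sample d n | (randomGraph d τ w₀ γ k w ω).Adj a b ∧
      (randomGraph d τ w₀ γ k w ω).Adj b c ∧ (randomGraph d τ w₀ γ k w ω).Adj c a} = ∅ := by
      ext ω
      simp only [Set.mem_ofPred_eq, Set.mem_empty_iff_false, iff_false]
      exact fun h' => h ⟨h'.1.ne, h'.2.1.ne, h'.2.2.ne⟩
    rw [this, measure_empty]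
    exact zero_le

end EdgeProbabilities

/-! ### False reports outside the community, by Markov's inequality -/

section OutsideCommunity

theorem mem_estimatedCommunity {n : ℕ} (w : Fin n → ℝ) (G : SimpleGraph (Fin n)) (a : Fin n) :
    a ∈ estimatedCommunity w G ↔
      localTriangles w G a > (n : ℝ) / (w a * Real.sqrt (Real.log n)) := by
  simp [estimatedCommunity]

theorem volume_mem_estimatedCommunity_le {d : ℕ} (hd : 1 ≤ d) {γ : ℝ≥0∞} (hγ : 1 < γ) {τ w₀ : ℝ}
    (hτ : 2 < τ) (hw₀ : 0 < w₀) {n k : ℕ} (hk : 1 ≤ k) (hkn : k ≤ n) (hn : 2 ≤ n) {w : Fin n → ℝ}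
    (hw : ∀ i, 0 < w i) {M : ℝ} (hM : ∑ i, w i ≤ M * n)
    (hMk : ∑ i ∈ community n k, w i ≤ M * k) {a : Fin n} (ha : a ∉ community n k) :
    volume {ω : Sample d n | a ∈ estimatedCommunity w (randomGraph d τ w₀ γ k w ω)} ≤
      ENNReal.ofReal ((profileConst d γ + 1) * M ^ 2 / meanWeight τ w₀ ^ 3 *
        (w a * Real.sqrt (Real.log n) / n)) := by
  classical
  have hμ := meanWeight_pos hτ hw₀
  set μ := meanWeight τ w₀
  set P := profileConst d γ
  have hP : 0 ≤ P := profileConst_nonneg d hγ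
  have hwa := hw a
  have hn' : (0 : ℝ) < n := by exact_mod_cast (by omega : 0 < n)
  have hk' : (0 : ℝ) < k := by exact_mod_cast hk
  have hkn' : (k : ℝ) ≤ n := by exact_mod_cast hkn
  have hL : 0 < Real.sqrt (Real.log n) :=
    Real.sqrt_pos.2 (Real.log_pos (by exact_mod_cast (by omega : 1 < n)))
  set L := Real.sqrt (Real.log n)
  let tri : Fin n → Fin n → Set (Sample d n) := fun b c =>
    {ω : Sample d n | (randomGraph d τ w₀ γ k w ω).Adj a b ∧
      (randomGraph d τ w₀ γ k w ω).Adj b c ∧ (randomGraph d τ w₀ γ k w ω).Adj c a}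
  have htri : ∀ b c, MeasurableSet (tri b c) := fun b c =>
    measurableSet_triangle d τ w₀ γ k w a b c
  let f : Sample d n → ℝ≥0∞ := fun ω =>
    ∑ b, ∑ c, (tri b c).indicator (fun _ => ENNReal.ofReal (1 / (w b * w c))) ω
  let q : Fin n → Fin n → ℝ := fun b c =>
    (if b ∈ community n k ∧ c ∈ community n k then P * (w b * w c / (μ * k)) else 0) +
        w b * w c / (μ * n)
  have hq : ∀ b c, 0 ≤ q b c := fun b c => by
    have := hw b
    have := hw c
    dsimp only [q]
    split_ifs <;> positivity
  have hqsum : ∑ b, ∑ c, q b c ≤ (P + 1) * M ^ 2 * n / μ := by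
    have hs1 : ∑ b, ∑ c, (if b ∈ community n k ∧ c ∈ community n k then
        P * (w b * w c / (μ * k)) else 0) = P * (∑ i ∈ community n k, w i) ^ 2 / (μ * k) := by
      rw [sq, Finset.sum_mul_sum, Finset.mul_sum, Finset.sum_div,
        ← Finset.sum_subset (Finset.subset_univ (community n k))]
      · refine Finset.sum_congr rfl fun b hb => ?_
        rw [Finset.mul_sum, Finset.sum_div,
          ← Finset.sum_subset (Finset.subset_univ (community n k))]
        · refine Finset.sum_congr rfl fun c hc => ?_
          rw [if_pos ⟨hb, hc⟩]
          ring
        · intro c _ hc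
          rw [if_neg fun h => hc h.2]
      · intro b _ hb
        exact Finset.sum_eq_zero fun c _ => if_neg fun h => hb h.1
    have hs2 : ∑ b, ∑ c, w b * w c / (μ * n) = (∑ i, w i) ^ 2 / (μ * n) := by
      rw [sq, Finset.sum_mul_sum, Finset.sum_div]
      refine Finset.sum_congr rfl fun b _ => ?_
      rw [Finset.sum_div]
    have e1 : (∑ i ∈ community n k, w i) ^ 2 ≤ (M * k) ^ 2 :=
      pow_le_pow_left₀ (Finset.sum_nonneg fun i _ => (hw i).le) hMk 2
    have e2 : (∑ i, w i) ^ 2 ≤ (M * n) ^ 2 :=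
      pow_le_pow_left₀ (Finset.sum_nonneg fun i _ => (hw i).le) hM 2
    simp only [q, Finset.sum_add_distrib]
    rw [hs1, hs2]
    calc P * (∑ i ∈ community n k, w i) ^ 2 / (μ * k) + (∑ i, w i) ^ 2 / (μ * n)
        ≤ P * (M * k) ^ 2 / (μ * k) + (M * n) ^ 2 / (μ * n) := by gcongr
      _ = P * M ^ 2 * k / μ + M ^ 2 * n / μ := by field_simp
      -- The community term is of order `k`, hence dominated by `n`.
      _ ≤ P * M ^ 2 * n / μ + M ^ 2 * n / μ := by gcongr
      _ = _ := by ring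
  have hf : ∫⁻ ω, f ω ≤ ENNReal.ofReal ((w a / (μ * n)) ^ 2 * ((P + 1) * M ^ 2 * n / μ)) := by
    calc ∫⁻ ω, f ω = ∑ b, ∑ c, ENNReal.ofReal (1 / (w b * w c)) * volume (tri b c) := by
          simp only [f]
          rw [lintegral_finsetSum _ fun b _ => Finset.measurable_sum _ fun c _ =>
            measurable_const.indicator (htri b c)]
          refine Finset.sum_congr rfl fun b _ => ?_
          rw [lintegral_finsetSum _ fun c _ => measurable_const.indicator (htri b c)]
          refine Finset.sum_congr rfl fun c _ => ?_
          rw [lintegral_indicator_const (htri b c)]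
      _ ≤ ∑ b, ∑ c, ENNReal.ofReal ((w a / (μ * n)) ^ 2 * q b c) := by
          refine Finset.sum_le_sum fun b _ => Finset.sum_le_sum fun c _ => ?_
          have hb := hw b
          have hc := hw c
          refine (mul_le_mul_right (volume_triangle_le hd hγ hτ hw₀ hk hw ha b c) _).trans ?_
          rw [← ENNReal.ofReal_mul (by positivity)]
          refine ENNReal.ofReal_le_ofReal (le_of_eq ?_)
          change _ * (w a * w b / (μ * n) * (w c * w a / (μ * n)) * q b c) = _
          field_simp
      _ = ENNReal.ofReal ((w a / (μ * n)) ^ 2 * ∑ b, ∑ c, q b c) := by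
          rw [Finset.mul_sum, ENNReal.ofReal_sum_of_nonneg fun b _ =>
            mul_nonneg (sq_nonneg _) (Finset.sum_nonneg fun c _ => hq b c)]
          refine Finset.sum_congr rfl fun b _ => ?_
          rw [Finset.mul_sum, ENNReal.ofReal_sum_of_nonneg fun c _ =>
            mul_nonneg (sq_nonneg _) (hq b c)]
      _ ≤ _ := ENNReal.ofReal_le_ofReal (by gcongr)
  -- Divided by `n / w_a ^ 2`, the test threshold becomes the level `w_a / L` for the weighted
  -- triangle sum `f`.
  have hsub : {ω : Sample d n | a ∈ estimatedCommunity w (randomGraph d τ w₀ γ k w ω)} ⊆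
      {ω | ENNReal.ofReal (w a / L) ≤ f ω} := by
    intro ω hω
    rw [Set.mem_ofPred_eq, mem_estimatedCommunity, localTriangles] at hω
    have hfω : f ω = ENNReal.ofReal (∑ b, ∑ c, if (randomGraph d τ w₀ γ k w ω).Adj a b ∧
        (randomGraph d τ w₀ γ k w ω).Adj b c ∧ (randomGraph d τ w₀ γ k w ω).Adj c a
        then 1 / (w b * w c) else 0) := by
      have h0 : ∀ b c, 0 ≤ if (randomGraph d τ w₀ γ k w ω).Adj a b ∧
        (randomGraph d τ w₀ γ k w ω).Adj b c ∧ (randomGraph d τ w₀ γ k w ω).Adj c a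
        then 1 / (w b * w c) else 0 := fun b c => by
          have hb := hw b
          have hc := hw c
          split_ifs <;> positivity
      rw [ENNReal.ofReal_sum_of_nonneg fun b _ => Finset.sum_nonneg fun c _ => h0 b c]
      refine Finset.sum_congr rfl fun b _ => ?_
      rw [ENNReal.ofReal_sum_of_nonneg fun c _ => h0 b c]
      refine Finset.sum_congr rfl fun c _ => ?_
      simp only [Set.indicator, tri, Set.mem_ofPred_eq]
      split_ifs <;> simp
    change _ ≤ f ω
    rw [hfω]
    refine ENNReal.ofReal_le_ofReal ?_
    have h2 : (n : ℝ) / w a ^ 2 * (w a / L) = n / (w a * L) := by field_simp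
    rw [gt_iff_lt, ← h2] at hω
    exact (lt_of_mul_lt_mul_left hω (by positivity)).le
  have hmk := (mul_meas_ge_le_lintegral₀ (μ := volume) (f := f) (Finset.measurable_sum _ fun b _ =>
    Finset.measurable_sum _ fun c _ => measurable_const.indicator (htri b c)).aemeasurable
    (ENNReal.ofReal (w a / L))).trans hf
  refine (measure_mono hsub).trans ?_
  have hpos : 0 < w a / L := by positivity
  rw [← ENNReal.mul_le_mul_iff_right (ENNReal.ofReal_pos.2 hpos).ne' ENNReal.ofReal_ne_top]
  refine hmk.trans ?_
  rw [← ENNReal.ofReal_mul hpos.le]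
  refine ENNReal.ofReal_le_ofReal (le_of_eq ?_)
  field_simp

end OutsideCommunity

/-! ### A Chebyshev bound for sums of indicators -/

section SecondMoment

/-- The second hypothesis says that the variance is at most `v`; falling to `m / 2` is a deviation
of at least `m / 2`. -/
theorem measureReal_sum_indicator_le_half_mean {Ω ι : Type*} [MeasurableSpace Ω] (μ : Measure Ω)
    [IsProbabilityMeasure μ] (P : Finset ι) (A : ι → Set Ω) (hA : ∀ p, MeasurableSet (A p))
    {m v : ℝ} (hm : 0 < m) (h1 : ∑ p ∈ P, μ.real (A p) = m)
    (h2 : ∑ p ∈ P, ∑ p' ∈ P, μ.real (A p ∩ A p') ≤ m ^ 2 + v) :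
    μ.real {ω | ∑ p ∈ P, (A p).indicator (fun _ => (1 : ℝ)) ω ≤ m / 2} ≤ 4 * v / m ^ 2 := by
  set X : Ω → ℝ := fun ω => ∑ p ∈ P, (A p).indicator (fun _ => (1 : ℝ)) ω
  have hi : ∀ s, MeasurableSet s → Integrable (s.indicator fun _ => (1 : ℝ)) μ := fun s hs =>
    (integrable_const 1).indicator hs
  have hX2 : ∀ ω, X ω ^ 2 = ∑ p ∈ P, ∑ p' ∈ P, (A p ∩ A p').indicator (fun _ => (1 : ℝ)) ω := by
    intro ω
    simp only [X, sq, Finset.sum_mul_sum]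
    refine Finset.sum_congr rfl fun p _ => Finset.sum_congr rfl fun p' _ => ?_
    by_cases hp : ω ∈ A p <;> by_cases hp' : ω ∈ A p' <;> simp [Set.indicator, hp, hp']
  have hXi : Integrable X μ := integrable_finsetSum _ fun p _ => hi _ (hA p)
  have hX2i : Integrable (fun ω => X ω ^ 2) μ := by
    simp only [hX2]
    exact integrable_finsetSum _ fun p _ => integrable_finsetSum _ fun p' _ =>
      hi _ ((hA p).inter (hA p'))
  have hEX : ∫ ω, X ω ∂μ = m := by
    simp only [X]
    rw [integral_finsetSum _ fun p _ => hi _ (hA p), ← h1]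
    refine Finset.sum_congr rfl fun p _ => ?_
    rw [integral_indicator_const _ (hA p), smul_eq_mul, mul_one]
  have hEX2 : ∫ ω, X ω ^ 2 ∂μ ≤ m ^ 2 + v := by
    refine le_trans (le_of_eq ?_) h2
    simp only [hX2]
    rw [integral_finsetSum _ fun p _ => integrable_finsetSum _ fun p' _ =>
      hi _ ((hA p).inter (hA p'))]
    refine Finset.sum_congr rfl fun p _ => ?_
    rw [integral_finsetSum _ fun p' _ => hi _ ((hA p).inter (hA p'))]
    refine Finset.sum_congr rfl fun p' _ => ?_
    rw [integral_indicator_const _ ((hA p).inter (hA p')), smul_eq_mul, mul_one]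
  have hexp : ∀ ω, (X ω - m) ^ 2 = X ω ^ 2 - 2 * m * X ω + m ^ 2 := fun ω => by ring
  have hint0 : Integrable (fun ω => X ω ^ 2 - 2 * m * X ω) μ := hX2i.sub (hXi.const_mul _)
  have hint : Integrable (fun ω => X ω ^ 2 - 2 * m * X ω + m ^ 2) μ :=
    hint0.add (integrable_const _)
  have hvar : ∫ ω, (X ω - m) ^ 2 ∂μ ≤ v := by
    simp only [hexp]
    rw [integral_add hint0 (integrable_const _),
      integral_sub hX2i (hXi.const_mul _), integral_const_mul, hEX]
    simp only [integral_const, probReal_univ, smul_eq_mul, one_mul]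
    linarith
  have hmk := mul_meas_ge_le_integral_of_nonneg (μ := μ) (f := fun ω => (X ω - m) ^ 2)
    (Filter.Eventually.of_forall fun ω => sq_nonneg _) (by simpa only [hexp] using hint)
    ((m / 2) ^ 2)
  have hsub : {ω | X ω ≤ m / 2} ⊆ {ω | (m / 2) ^ 2 ≤ (X ω - m) ^ 2} := by
    intro ω hω
    change X ω ≤ m / 2 at hω
    change (m / 2) ^ 2 ≤ (X ω - m) ^ 2
    nlinarith
  have hle := measureReal_mono (μ := μ) hsub
  rw [le_div_iff₀ (by positivity)]
  nlinarith [mul_le_mul_of_nonneg_left hle (sq_nonneg (m / 2))]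

end SecondMoment

/-! ### Missed vertices inside the community, by the second moment -/

section InsideCommunity

/-- The event that the positions of `i` and `j` are at distance at most `v ^ (1 / d)`. -/
def near (d : ℕ) {n : ℕ} (i j : Fin n) (v : ℝ) : Set (Fin n → UnitAddTorus (Fin d)) :=
  {x | ‖x i - x j‖ ^ d ≤ v}

theorem measurableSet_near (d : ℕ) {n : ℕ} (i j : Fin n) (v : ℝ) :
    MeasurableSet (near d i j v) :=
  measurableSet_le (measurable_sub_norm_pow i j) measurable_const

theorem update_mem_near {d n : ℕ} {i j l : Fin n} (hi : i ≠ l) (hj : j ≠ l) (v : ℝ)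
    (x : Fin n → UnitAddTorus (Fin d)) (y : UnitAddTorus (Fin d)) :
    Function.update x l y ∈ near d i j v ↔ x ∈ near d i j v := by
  simp [near, Function.update_of_ne hi, Function.update_of_ne hj]

theorem volume_path_two {d n : ℕ} {a b c : Fin n} (hab : a ≠ b) (hac : a ≠ c) (hbc : b ≠ c)
    (α β : ℝ) : volume (near d b a α ∩ near d c b β) = ballVol d α * ballVol d β := by
  rw [← volume_near (d := d) hab.symm α]
  exact volume_inter_near hbc.symm β (measurableSet_near d b a α)
    (update_mem_near hbc hac α)

/-- The leaf `e` must be new, while `f` is any other vertex: it will be the `b` or the `c` shared by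
two overlapping triangles. -/
theorem volume_path_three {d n : ℕ} {a b c e f : Fin n} (hab : a ≠ b) (hac : a ≠ c) (hbc : b ≠ c)
    (hae : a ≠ e) (hbe : b ≠ e) (hce : c ≠ e) (hef : e ≠ f) (α β : ℝ) :
    volume (near d b a α ∩ near d c b β ∩ near d e f β)
      = ballVol d α * ballVol d β * ballVol d β := by
  rw [← volume_path_two hab hac hbc α β]
  exact volume_inter_near hef β ((measurableSet_near d b a α).inter (measurableSet_near d c b β))
    fun x y => and_congr (update_mem_near hbe hae α x y) (update_mem_near hce hbe β x y)

theorem volume_path_two_two {d n : ℕ} {a b c b' c' : Fin n} (hab : a ≠ b) (hac : a ≠ c)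
    (hbc : b ≠ c) (hab' : a ≠ b') (hac' : a ≠ c') (hb'c' : b' ≠ c') (hbb' : b ≠ b') (hbc' : b ≠ c')
    (hcb' : c ≠ b') (hcc' : c ≠ c') (α β : ℝ) :
    volume (near d b a α ∩ near d c b β ∩ near d b' a α ∩ near d c' b' β)
      = ballVol d α * ballVol d β * ballVol d α * ballVol d β := by
  have h3 : volume (near d b a α ∩ near d c b β ∩ near d b' a α)
      = ballVol d α * ballVol d β * ballVol d α := by
    rw [← volume_path_two hab hac hbc α β]
    exact volume_inter_near hab'.symm α
      ((measurableSet_near d b a α).inter (measurableSet_near d c b β))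
      fun x y => and_congr (update_mem_near hbb' hab' α x y) (update_mem_near hcb' hbb' β x y)
  rw [← h3]
  exact volume_inter_near hb'c'.symm β
    (((measurableSet_near d b a α).inter (measurableSet_near d c b β)).inter
      (measurableSet_near d b' a α))
    fun x y => and_congr
      (and_congr (update_mem_near hbc' hac' α x y) (update_mem_near hcc' hbc' β x y))
      (update_mem_near hb'c' hac' α x y)

/-- The three sides of a triangle. -/
def sides {n : ℕ} (a b c : Fin n) : Finset (Sym2 (Fin n)) := {s(a, b), s(b, c), s(c, a)}

theorem card_sides {n : ℕ} {a b c : Fin n} (hab : a ≠ b) (hac : a ≠ c) (hbc : b ≠ c) :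
    (sides a b c).card = 3 := by
  refine Finset.card_eq_three.2 ⟨_, _, _, ?_, ?_, ?_, rfl⟩ <;>
    simp [hab, hac, hbc, hab.symm, hac.symm]

theorem disjoint_sides {n : ℕ} {a b c b' c' : Fin n} (hab : a ≠ b) (hac : a ≠ c)
    (hab' : a ≠ b') (hac' : a ≠ c') (hbb' : b ≠ b') (hbc' : b ≠ c')
    (hcb' : c ≠ b') (hcc' : c ≠ c') : Disjoint (sides a b c) (sides a b' c') := by
  rw [Finset.disjoint_left]
  intro e he he'
  simp only [sides, Finset.mem_insert, Finset.mem_singleton] at he he'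
  rcases he with rfl | rfl | rfl <;>
    simp_all [eq_comm]

/-- The event that all the uniform variables of the pairs in `S` are below `q`. -/
def allBelow {n : ℕ} (S : Finset (Sym2 (Fin n))) (q : ℝ) : Set (Sym2 (Fin n) → unitInterval) :=
  {u | ∀ e ∈ S, (u e : ℝ) < q}

theorem volume_allBelow {n : ℕ} (S : Finset (Sym2 (Fin n))) {q : ℝ} (h0 : 0 ≤ q) (h1 : q ≤ 1) :
    volume (allBelow S q) = ENNReal.ofReal q ^ S.card := by
  rw [allBelow, volume_uniforms S (fun _ => q) (fun _ _ => h0) fun _ _ => h1, Finset.prod_const]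

theorem measurableSet_allBelow {n : ℕ} (S : Finset (Sym2 (Fin n))) (q : ℝ) :
    MeasurableSet (allBelow S q) := by
  have : allBelow S q = ⋂ e ∈ S, {u | (u e : ℝ) < q} := by
    ext u
    simp [allBelow]
  rw [this]
  exact S.measurableSet_biInter fun e _ =>
    measurableSet_lt (measurable_subtype_coe.comp (measurable_pi_apply e)) measurable_const

/-- The event that `b` is close to `a`, `c` is close to `b`, and the uniform variables of the
sides of the triangle `a b c` are below `q`. -/
def closeTriangle (d : ℕ) {n : ℕ} (α β q : ℝ) (a b c : Fin n) : Set (Sample d n) :=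
  (near d b a α ∩ near d c b β) ×ˢ allBelow (sides a b c) q

theorem measurableSet_closeTriangle (d : ℕ) {n : ℕ} (α β q : ℝ) (a b c : Fin n) :
    MeasurableSet (closeTriangle d α β q a b c) :=
  ((measurableSet_near d b a α).inter (measurableSet_near d c b β)).prod
    (measurableSet_allBelow _ q)

theorem volume_closeTriangle {d n : ℕ} {a b c : Fin n} (hab : a ≠ b) (hac : a ≠ c) (hbc : b ≠ c)
    {α β q : ℝ} (h0 : 0 ≤ q) (h1 : q ≤ 1) :
    volume.real (closeTriangle d α β q a b c)
      = (ballVol d α).toReal * (ballVol d β).toReal * q ^ 3 := by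
  rw [closeTriangle, measureReal_def, Measure.volume_eq_prod, Measure.prod_prod,
    volume_path_two hab hac hbc, volume_allBelow _ h0 h1, card_sides hab hac hbc]
  simp [h0]

/-- Triangles sharing only `a` have disjoint sides and closeness conditions forming a tree, so they
are independent. In the overlapping cases the uniform variables are discarded and just enough
closeness conditions are kept to form a tree. -/
theorem volume_closeTriangle_inter_le {d n : ℕ} {a b c b' c' : Fin n} (hab : a ≠ b) (hac : a ≠ c)
    (hbc : b ≠ c) (hab' : a ≠ b') (hac' : a ≠ c') (hb'c' : b' ≠ c') (hbc' : b ≠ c')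
    (hcb' : c ≠ b') {α β q A B : ℝ} (h0 : 0 ≤ q) (h1 : q ≤ 1) (hA : (ballVol d α).toReal = A)
    (hB : (ballVol d β).toReal = B) :
    volume.real (closeTriangle d α β q a b c ∩ closeTriangle d α β q a b' c') ≤
      (A * B * q ^ 3) ^ 2 + (if b = b' then A * B ^ 2 else 0) +
        (if c = c' then A * B ^ 2 else 0) + (if b = b' ∧ c = c' then A * B else 0) := by
  have hA0 : 0 ≤ A := hA ▸ ENNReal.toReal_nonneg
  have hB0 : 0 ≤ B := hB ▸ ENNReal.toReal_nonneg
  have hpos : ∀ S : Set (Fin n → UnitAddTorus (Fin d)),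
      closeTriangle d α β q a b c ∩ closeTriangle d α β q a b' c' ⊆ S ×ˢ Set.univ →
      volume.real (closeTriangle d α β q a b c ∩ closeTriangle d α β q a b' c')
        ≤ (volume S).toReal := by
    intro S hS
    refine (measureReal_mono hS).trans (le_of_eq ?_)
    rw [measureReal_def, Measure.volume_eq_prod, Measure.prod_prod, measure_univ, mul_one]
  by_cases hb : b = b'
  · subst hb
    by_cases hc : c = c'
    · subst hc
      refine (hpos (near d b a α ∩ near d c b β) fun ω hω => ⟨hω.1.1, trivial⟩).trans ?_
      rw [volume_path_two hab hac hbc, ENNReal.toReal_mul, hA, hB]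
      simp only [and_self, if_true]
      have : 0 ≤ A * B ^ 2 := by positivity
      have : 0 ≤ (A * B * q ^ 3) ^ 2 := by positivity
      linarith
    · refine (hpos (near d b a α ∩ near d c b β ∩ near d c' b β)
        fun ω hω => ⟨⟨hω.1.1, hω.2.1.2⟩, trivial⟩).trans ?_
      rw [volume_path_three hab hac hbc hac' hbc' hc hbc'.symm, ENNReal.toReal_mul,
        ENNReal.toReal_mul, hA, hB]
      simp only [hc, and_false, if_false, if_true]
      have : 0 ≤ (A * B * q ^ 3) ^ 2 := by positivity
      linarith
  · by_cases hc : c = c'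
    · subst hc
      -- The condition joining `b'` to `a` is dropped, as it would close a cycle; `b'` hangs as a
      -- leaf from the common vertex `c`.
      refine (hpos (near d b a α ∩ near d c b β ∩ near d b' c β)
        fun ω hω => ⟨⟨hω.1.1, ?_⟩, trivial⟩).trans ?_
      · have := hω.2.1.2
        simp only [near, Set.mem_ofPred_eq] at this ⊢
        rwa [norm_sub_rev]
      rw [volume_path_three hab hac hbc hab' hb hcb' hcb'.symm, ENNReal.toReal_mul,
        ENNReal.toReal_mul, hA, hB]
      simp only [hb, false_and, if_false, if_true]
      have : 0 ≤ (A * B * q ^ 3) ^ 2 := by positivity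
      linarith
    · have hsub : closeTriangle d α β q a b c ∩ closeTriangle d α β q a b' c' ⊆
          (near d b a α ∩ near d c b β ∩ near d b' a α ∩ near d c' b' β) ×ˢ
            allBelow (sides a b c ∪ sides a b' c') q := by
        rintro ω ⟨h, h'⟩
        refine ⟨⟨⟨h.1, h'.1.1⟩, h'.1.2⟩, fun e he => ?_⟩
        rcases Finset.mem_union.1 he with he | he
        · exact h.2 e he
        · exact h'.2 e he
      refine (measureReal_mono hsub).trans (le_of_eq ?_)
      rw [measureReal_def, Measure.volume_eq_prod, Measure.prod_prod,
        volume_path_two_two hab hac hbc hab' hac' hb'c' hb hbc' hcb' hc, volume_allBelow _ h0 h1,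
        Finset.card_union_of_disjoint (disjoint_sides hab hac hab' hac' hb hbc' hcb' hc),
        card_sides hab hac hbc, card_sides hab' hac' hb'c']
      simp only [ENNReal.toReal_mul, ENNReal.toReal_pow, ENNReal.toReal_ofReal h0, hA, hB, hb, hc,
        and_self, if_false]
      ring

/-- The division by `2 ^ d` in the radii absorbs the factor `2` lost in the triangle inequality from
`c` to `a`. At these distances the profile equals `1`, so the edge probability is exactly the
retention probability. -/
theorem closeTriangle_subset {d : ℕ} {γ : ℝ≥0∞} {τ w₀ : ℝ} (hτ : 2 < τ)
    (hw₀ : 0 < w₀) {n k : ℕ} (hk : 1 ≤ k) {w : Fin n → ℝ} {a b c : Fin n}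
    (ha : a ∈ community n k) (hb : b ∈ community n k) (hc : c ∈ community n k)
    (hwa : w₀ ≤ w a) (hwb : w₀ ≤ w b) (hwc : w₀ ≤ w c) (hab : a ≠ b) (hac : a ≠ c) (hbc : b ≠ c) :
    closeTriangle d (w a * w₀ / (meanWeight τ w₀ * k) / 2 ^ d)
      (w₀ * w₀ / (meanWeight τ w₀ * k) / 2 ^ d) (retention d γ) a b c ⊆
    {ω : Sample d n | (randomGraph d τ w₀ γ k w ω).Adj a b ∧
      (randomGraph d τ w₀ γ k w ω).Adj b c ∧ (randomGraph d τ w₀ γ k w ω).Adj c a} := by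
  rintro ω ⟨⟨h1, h2⟩, hu⟩
  have hμ := meanWeight_pos hτ hw₀
  set μ := meanWeight τ w₀
  have hk' : (0 : ℝ) < k := by exact_mod_cast hk
  simp only [near, Set.mem_ofPred_eq] at h1 h2
  have hwa' := hw₀.trans_le hwa
  have two : (1 : ℝ) ≤ 2 ^ d := one_le_pow₀ (by norm_num)
  have hdiv : ∀ s : ℝ, 0 ≤ s → s / 2 ^ d ≤ s := fun s hs => div_le_self hs two
  have hba : ‖ω.1 a - ω.1 b‖ ^ d ≤ w a * w b / (μ * k) := by
    rw [norm_sub_rev]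
    refine h1.trans ((hdiv _ (by positivity)).trans ?_)
    gcongr
  have hcb : ‖ω.1 b - ω.1 c‖ ^ d ≤ w b * w c / (μ * k) := by
    rw [norm_sub_rev]
    refine h2.trans ((hdiv _ (by positivity)).trans ?_)
    have := hw₀.trans_le hwb
    gcongr
  have hca : ‖ω.1 c - ω.1 a‖ ^ d ≤ w c * w a / (μ * k) := by
    have htri : ‖ω.1 c - ω.1 a‖ ≤ 2 * max ‖ω.1 b - ω.1 a‖ ‖ω.1 c - ω.1 b‖ := by
      have := norm_sub_le_norm_sub_add_norm_sub (ω.1 c) (ω.1 b) (ω.1 a)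
      have := le_max_left ‖ω.1 b - ω.1 a‖ ‖ω.1 c - ω.1 b‖
      have := le_max_right ‖ω.1 b - ω.1 a‖ ‖ω.1 c - ω.1 b‖
      linarith
    have hmax : (max ‖ω.1 b - ω.1 a‖ ‖ω.1 c - ω.1 b‖) ^ d ≤ w a * w₀ / (μ * k) / 2 ^ d := by
      rcases max_choice ‖ω.1 b - ω.1 a‖ ‖ω.1 c - ω.1 b‖ with h | h <;> rw [h]
      · exact h1
      · refine h2.trans ?_
        gcongr
    calc ‖ω.1 c - ω.1 a‖ ^ d ≤ (2 * max ‖ω.1 b - ω.1 a‖ ‖ω.1 c - ω.1 b‖) ^ d :=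
          pow_le_pow_left₀ (norm_nonneg _) htri d
      _ ≤ 2 ^ d * (w a * w₀ / (μ * k) / 2 ^ d) := by rw [mul_pow]; gcongr
      _ = w a * w₀ / (μ * k) := by field_simp
      _ ≤ w c * w a / (μ * k) := by rw [mul_comm (w a)]; gcongr
  have hadj : ∀ i j : Fin n, i ∈ community n k → j ∈ community n k → i ≠ j →
      ‖ω.1 i - ω.1 j‖ ^ d ≤ w i * w j / (μ * k) → (ω.2 s(i, j) : ℝ) < retention d γ →
      (randomGraph d τ w₀ γ k w ω).Adj i j := by
    intro i j hi hj hij hn hlt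
    refine ⟨hij, ?_⟩
    unfold edgeProb
    rw [if_pos ⟨hi, hj⟩, geomProfile_of_le γ hn, mul_one]
    exact hlt
  exact ⟨hadj a b ha hb hab hba (hu _ (by simp [sides])),
    hadj b c hb hc hbc hcb (hu _ (by simp [sides])),
    hadj c a hc ha hac.symm hca (hu _ (by simp [sides]))⟩

theorem sum_closeTriangle_le {d : ℕ} {γ : ℝ≥0∞} {τ w₀ : ℝ} (hτ : 2 < τ)
    (hw₀ : 0 < w₀) {n k : ℕ} (hk : 1 ≤ k) {w : Fin n → ℝ} (hw : ∀ i, 0 < w i) {a : Fin n}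
    (ha : a ∈ community n k) (hwa : w₀ ≤ w a) {B₁ B₂ : Finset (Fin n)} {R : ℝ}
    (hB : ∀ b ∈ B₁ ∪ B₂, b ∈ community n k ∧ w₀ ≤ w b ∧ w b ≤ R ∧ a ≠ b)
    (hdisj : Disjoint B₁ B₂) (ω : Sample d n) :
    ∑ p ∈ B₁ ×ˢ B₂, (closeTriangle d (w a * w₀ / (meanWeight τ w₀ * k) / 2 ^ d)
      (w₀ * w₀ / (meanWeight τ w₀ * k) / 2 ^ d) (retention d γ) a p.1 p.2).indicator
        (fun _ => (1 : ℝ)) ω * (n / (w a ^ 2 * R ^ 2)) ≤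
    localTriangles w (randomGraph d τ w₀ γ k w ω) a := by
  classical
  unfold localTriangles
  rw [← Fintype.sum_prod_type', Finset.mul_sum]
  refine le_trans (Finset.sum_le_sum fun p hp => ?_) (Finset.sum_le_univ_sum_of_nonneg
    (s := B₁ ×ˢ B₂) fun p => ?_)
  · obtain ⟨hp1, hp2⟩ := Finset.mem_product.1 hp
    obtain ⟨c1, l1, u1, n1⟩ := hB p.1 (Finset.mem_union_left _ hp1)
    obtain ⟨c2, l2, u2, n2⟩ := hB p.2 (Finset.mem_union_right _ hp2)
    have hne : p.1 ≠ p.2 := fun h => Finset.disjoint_left.1 hdisj hp1 (h ▸ hp2)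
    have h1 := hw p.1
    have h2 := hw p.2
    have h3 := hw a
    have hR := h1.le.trans u1
    by_cases hω : ω ∈ closeTriangle d (w a * w₀ / (meanWeight τ w₀ * k) / 2 ^ d)
      (w₀ * w₀ / (meanWeight τ w₀ * k) / 2 ^ d) (retention d γ) a p.1 p.2
    · have ht := closeTriangle_subset hτ hw₀ hk ha c1 c2 hwa l1 l2 n1 n2 hne hω
      rw [Set.mem_ofPred_eq] at ht
      rw [Set.indicator_of_mem hω, if_pos ht, one_mul, div_mul_div_comm, mul_one, sq R]
      gcongr
    · rw [Set.indicator_of_notMem hω, zero_mul]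
      split_ifs <;> positivity
  · have h1 := hw p.1
    have h2 := hw p.2
    have h3 := hw a
    split_ifs <;> positivity

/-- The hypothesis `hthr` places the test threshold below the value of the statistic at half the
mean number of close triangles, so a missed vertex has at most half that mean. Disjointness of `B₁`
and `B₂` leaves `b = b'` and `c = c'` as the only possible overlaps. -/
theorem volume_notMem_estimatedCommunity_le {d : ℕ} (hd : 1 ≤ d) {γ : ℝ≥0∞} {τ w₀ : ℝ}
    (hτ : 2 < τ) (hw₀ : 0 < w₀) {n k : ℕ} (hk : 1 ≤ k) (hn : 2 ≤ n) {w : Fin n → ℝ}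
    (hw : ∀ i, 0 < w i) {a : Fin n}
    (ha : a ∈ community n k) (hwa : w₀ ≤ w a) {B₁ B₂ : Finset (Fin n)} {R : ℝ} (hR : 0 < R) {N : ℕ}
    (hN : 1 ≤ N) (hB : ∀ b ∈ B₁ ∪ B₂, b ∈ community n k ∧ w₀ ≤ w b ∧ w b ≤ R ∧ a ≠ b)
    (hdisj : Disjoint B₁ B₂) (hN₁ : B₁.card = N) (hN₂ : B₂.card = N) {α β q : ℝ}
    (hα : α = w a * w₀ / (meanWeight τ w₀ * k)) (hβ : β = w₀ * w₀ / (meanWeight τ w₀ * k))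
    (hq : q = retention d γ) (hα1 : α ≤ 1)
    (hthr : R ^ 2 * (w a / Real.sqrt (Real.log n)) ≤ N ^ 2 * (α * β * q ^ 3) / 2) :
    volume.real {ω : Sample d n | a ∉ estimatedCommunity w (randomGraph d τ w₀ γ k w ω)} ≤
      4 * (2 * N ^ 3 * (α * β ^ 2) + N ^ 2 * (α * β)) / (N ^ 2 * (α * β * q ^ 3)) ^ 2 := by
  have hμ := meanWeight_pos hτ hw₀
  have hk' : (0 : ℝ) < k := by exact_mod_cast hk
  have hN' : (0 : ℝ) < N := by exact_mod_cast hN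
  have hwa' := hw a
  have hα0 : 0 < α := by rw [hα]; positivity
  have hβ0 : 0 < β := by rw [hβ]; positivity
  have hq0 : 0 < q := hq ▸ retention_pos d γ
  have hq1 : q ≤ 1 := hq ▸ retention_le_one d γ
  have hβα : β ≤ α := by rw [hα, hβ]; gcongr
  have hvol : ∀ s : ℝ, 0 ≤ s → s ≤ 1 → (ballVol d (s / 2 ^ d)).toReal = s := by
    intro s hs0 hs1
    rw [ballVol_eq hd (by positivity), mul_div_cancel₀ _ (by positivity), min_eq_right hs1,
      ENNReal.toReal_ofReal hs0]
  have hvα := hvol α hα0.le hα1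
  have hvβ := hvol β hβ0.le (hβα.trans hα1)
  have hdist : ∀ p ∈ B₁ ×ˢ B₂, a ≠ p.1 ∧ a ≠ p.2 := fun p hp =>
    ⟨(hB _ (Finset.mem_union_left _ (Finset.mem_product.1 hp).1)).2.2.2,
      (hB _ (Finset.mem_union_right _ (Finset.mem_product.1 hp).2)).2.2.2⟩
  have hne : ∀ b ∈ B₁, ∀ c ∈ B₂, b ≠ c := fun b hb c hc h =>
    Finset.disjoint_left.1 hdisj hb (h ▸ hc)
  have hm : 0 < N ^ 2 * (α * β * q ^ 3) := by positivity
  have key := measureReal_sum_indicator_le_half_mean (volume : Measure (Sample d n)) (B₁ ×ˢ B₂)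
    (fun p => closeTriangle d (α / 2 ^ d) (β / 2 ^ d) q a p.1 p.2)
    (fun p => measurableSet_closeTriangle d _ _ q a p.1 p.2) hm
    (v := 2 * N ^ 3 * (α * β ^ 2) + N ^ 2 * (α * β)) ?_ ?_
  · refine (measureReal_mono fun ω hω => ?_).trans key
    rw [Set.mem_ofPred_eq, mem_estimatedCommunity, gt_iff_lt, not_lt] at hω
    have hL : 0 < Real.sqrt (Real.log n) :=
      Real.sqrt_pos.2 (Real.log_pos (by exact_mod_cast (by omega : 1 < n)))
    have hn' : (0 : ℝ) < n := by exact_mod_cast (by omega : 0 < n)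
    have h := (sum_closeTriangle_le (γ := γ) hτ hw₀ hk hw ha hwa hB hdisj ω).trans hω
    rw [← hα, ← hβ, ← hq, ← Finset.sum_mul] at h
    refine le_trans ?_ hthr
    rw [← le_div_iff₀ (by positivity)] at h
    refine h.trans (le_of_eq ?_)
    field_simp
  · rw [Finset.sum_congr rfl fun p hp => volume_closeTriangle (hdist p hp).1 (hdist p hp).2
      (hne _ (Finset.mem_product.1 hp).1 _ (Finset.mem_product.1 hp).2) hq0.le hq1, hvα, hvβ,
      Finset.sum_const, Finset.card_product, hN₁, hN₂, nsmul_eq_mul]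
    push_cast
    ring
  · refine (Finset.sum_le_sum fun p hp => Finset.sum_le_sum fun p' hp' =>
      volume_closeTriangle_inter_le (hdist p hp).1 (hdist p hp).2
      (hne _ (Finset.mem_product.1 hp).1 _ (Finset.mem_product.1 hp).2)
      (hdist p' hp').1 (hdist p' hp').2
      (hne _ (Finset.mem_product.1 hp').1 _ (Finset.mem_product.1 hp').2)
      (hne _ (Finset.mem_product.1 hp).1 _ (Finset.mem_product.1 hp').2)
      (hne _ (Finset.mem_product.1 hp').1 _ (Finset.mem_product.1 hp).2).symm
      hq0.le hq1 hvα hvβ).trans (le_of_eq ?_)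
    -- For fixed `p`, exactly `N` pairs share its first coordinate, `N` its second, and one shares
    -- both.
    have s1 : ∀ p ∈ B₁ ×ˢ B₂, ∑ p' ∈ B₁ ×ˢ B₂, (if p.1 = p'.1 then α * β ^ 2 else 0)
        = N * (α * β ^ 2) := by
      intro p hp
      rw [Finset.sum_product_right]
      simp [(Finset.mem_product.1 hp).1, hN₂]
    have s2 : ∀ p ∈ B₁ ×ˢ B₂, ∑ p' ∈ B₁ ×ˢ B₂, (if p.2 = p'.2 then α * β ^ 2 else 0)
        = N * (α * β ^ 2) := by
      intro p hp
      rw [Finset.sum_product]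
      simp [(Finset.mem_product.1 hp).2, hN₁]
    have s3 : ∀ p ∈ B₁ ×ˢ B₂, ∑ p' ∈ B₁ ×ˢ B₂, (if p.1 = p'.1 ∧ p.2 = p'.2 then α * β else 0)
        = α * β := by
      intro p hp
      simp only [← Prod.ext_iff]
      rw [Finset.sum_ite_eq, if_pos hp]
    simp only [Finset.sum_add_distrib]
    rw [Finset.sum_congr rfl s1, Finset.sum_congr rfl s2, Finset.sum_congr rfl s3]
    simp only [Finset.sum_const, Finset.card_product, hN₁, hN₂, nsmul_eq_mul]
    push_cast
    ring

end InsideCommunity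

/-! ### Tails and moments of the weights -/

section Weights

theorem card_community {n k : ℕ} (hkn : k ≤ n) : (community n k).card = k := by
  have : community n k = Finset.univ.map (Fin.castLEEmb hkn) := by
    ext i
    simp only [community, Finset.mem_filter, Finset.mem_univ, true_and, Finset.mem_map,
      Fin.castLEEmb_apply]
    constructor
    · intro h
      exact ⟨⟨i, h⟩, rfl⟩
    · rintro ⟨j, rfl⟩
      exact j.2
  rw [this, Finset.card_map, Finset.card_univ, Fintype.card_fin]

theorem card_filter_lt_eq {n : ℕ} {S : Finset (Fin n)} (hS : 0 < S.card) (w : Fin n → ℝ) (x : ℝ) :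
    ((S.filter fun i => x < w i).card : ℝ) = S.card * (1 - empCDF S w x) := by
  have h := Finset.card_filter_add_card_filter_not (s := S) fun i => w i ≤ x
  simp only [not_le] at h
  have h' : ((S.filter fun i => w i ≤ x).card : ℝ) + (S.filter fun i => x < w i).card = S.card := by
    exact_mod_cast h
  have hS' : (0 : ℝ) < S.card := by exact_mod_cast hS
  unfold empCDF
  rw [mul_sub, mul_div_cancel₀ _ hS'.ne']
  linarith

/-- Layer cake for `w ^ s`: below `w₀` the tail count is at most `|S|`, and above it `x ^ (s - 1 -
β)` is integrable at infinity because `s < β`. -/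
theorem sum_rpow_le_of_tail {n : ℕ} {S : Finset (Fin n)} {w : Fin n → ℝ} (hw : ∀ i, 0 < w i)
    {w₀ D β s : ℝ} (hw₀ : 0 < w₀) (hD : 0 ≤ D) (hs : 0 < s) (hsβ : s < β)
    (htail : ∀ x, w₀ ≤ x → ((S.filter fun i => x < w i).card : ℝ) ≤ D * S.card * x ^ (-β)) :
    ∑ i ∈ S, w i ^ s ≤ (w₀ ^ s + s * D * (w₀ ^ (s - β) / (β - s))) * S.card := by
  let m : Measure (Fin n) := Measure.count.restrict S
  have hm : ∀ t, m {i | t < w i} = ENNReal.ofReal ((S.filter fun i => t < w i).card : ℝ) := by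
    intro t
    have : {i | t < w i} ∩ (S : Set (Fin n)) = ↑(S.filter fun i => t < w i) := by
      ext i
      simp [and_comm]
    simp only [m]
    rw [Measure.restrict_apply MeasurableSet.of_discrete, this, Measure.count_apply_finset,
      ENNReal.ofReal_natCast]
  have hlc := lintegral_rpow_eq_lintegral_meas_lt_mul m (f := w)
    (Filter.Eventually.of_forall fun i => (hw i).le) (by fun_prop) hs
  have hsum : ∫⁻ i, ENNReal.ofReal (w i ^ s) ∂m = ENNReal.ofReal (∑ i ∈ S, w i ^ s) := by
    simp only [m]
    rw [lintegral_finset, ENNReal.ofReal_sum_of_nonneg fun i _ => Real.rpow_nonneg (hw i).le s]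
    simp
  have hI1 : IntegrableOn (fun t : ℝ => (S.card : ℝ) * t ^ (s - 1)) (Set.Ioc 0 w₀) :=
    ((intervalIntegrable_iff_integrableOn_Ioc_of_le hw₀.le).1
      (intervalIntegral.intervalIntegrable_rpow' (by linarith))).const_mul _
  have hI2 : IntegrableOn (fun t : ℝ => D * S.card * t ^ (s - 1 - β)) (Set.Ioi w₀) :=
    (integrableOn_Ioi_rpow_of_lt (by linarith) hw₀).const_mul _
  have b1 : ∫⁻ t in Set.Ioc 0 w₀, m {i | t < w i} * ENNReal.ofReal (t ^ (s - 1)) ≤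
      ENNReal.ofReal (S.card * (w₀ ^ s / s)) := by
    calc _ ≤ ∫⁻ t in Set.Ioc 0 w₀, ENNReal.ofReal (S.card * t ^ (s - 1)) := by
          refine setLIntegral_mono' measurableSet_Ioc fun t ht => ?_
          rw [hm, ← ENNReal.ofReal_mul (by positivity)]
          refine ENNReal.ofReal_le_ofReal (mul_le_mul_of_nonneg_right ?_
            (Real.rpow_nonneg ht.1.le _))
          exact_mod_cast Finset.card_filter_le _ _
      _ = ENNReal.ofReal (S.card * (w₀ ^ s / s)) := by
          rw [← ofReal_integral_eq_lintegral_ofReal hI1]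
          · rw [integral_const_mul, ← intervalIntegral.integral_of_le hw₀.le,
              integral_rpow (Or.inl (by linarith)), sub_add_cancel, Real.zero_rpow hs.ne', sub_zero]
          · refine (ae_restrict_iff' measurableSet_Ioc).2 (Filter.Eventually.of_forall fun t ht => ?_)
            have := Real.rpow_nonneg ht.1.le (s - 1)
            positivity
  have b2 : ∫⁻ t in Set.Ioi w₀, m {i | t < w i} * ENNReal.ofReal (t ^ (s - 1)) ≤
      ENNReal.ofReal (D * S.card * (w₀ ^ (s - β) / (β - s))) := by
    calc _ ≤ ∫⁻ t in Set.Ioi w₀, ENNReal.ofReal (D * S.card * t ^ (s - 1 - β)) := by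
          refine setLIntegral_mono' measurableSet_Ioi fun t ht => ?_
          have ht0 : 0 < t := hw₀.trans ht
          rw [hm, ← ENNReal.ofReal_mul (by positivity)]
          refine ENNReal.ofReal_le_ofReal ?_
          rw [sub_eq_add_neg (s - 1), Real.rpow_add ht0, mul_comm (t ^ (s - 1)), ← mul_assoc]
          exact mul_le_mul_of_nonneg_right (htail t (le_of_lt ht)) (Real.rpow_nonneg ht0.le _)
      _ = _ := by
          rw [← ofReal_integral_eq_lintegral_ofReal hI2]
          · rw [integral_const_mul, integral_Ioi_rpow_of_lt (by linarith) hw₀]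
            have e1 : s - 1 - β + 1 = s - β := by ring
            have e2 : s - β = -(β - s) := by ring
            rw [e1, neg_div, ← div_neg]
            congr 4
            ring
          · refine (ae_restrict_iff' measurableSet_Ioi).2 (Filter.Eventually.of_forall fun t ht => ?_)
            have := Real.rpow_nonneg (hw₀.trans ht).le (s - 1 - β)
            positivity
  rw [hsum, ← Set.Ioc_union_Ioi_eq_Ioi hw₀.le] at hlc
  have hβs : 0 < β - s := by linarith
  have hle : ENNReal.ofReal (∑ i ∈ S, w i ^ s) ≤ ENNReal.ofReal
      (s * (S.card * (w₀ ^ s / s) + D * S.card * (w₀ ^ (s - β) / (β - s)))) := by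
    rw [hlc, ENNReal.ofReal_mul hs.le, ENNReal.ofReal_add (by positivity) (by positivity)]
    gcongr
    exact (lintegral_union_le _ _ _).trans (add_le_add b1 b2)
  refine ((ENNReal.ofReal_le_ofReal_iff (by positivity)).1 hle).trans (le_of_eq ?_)
  field_simp

/-- Eventual upper bound for the tail of the empirical distribution, with a slightly smaller
exponent but without any restriction on the range. -/
theorem eventually_card_filter_lt_le {τ C w₀ β : ℝ} (hτ : 2 < τ) (hC : 0 < C) (hw₀ : 0 < w₀)
    (hβ0 : 0 < β) (hβ : β < τ - 1) {m : ℕ → ℕ} (hm : Tendsto m atTop atTop)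
    {S : (n : ℕ) → Finset (Fin n)} (hS : ∀ᶠ n in atTop, (S n).card = m n) {w : (n : ℕ) → Fin n → ℝ}
    (hF : ∀ ε : ℝ, 0 < ε → ∀ᶠ n : ℕ in atTop, ∀ x : ℝ, w₀ ≤ x →
      x ≤ (m n : ℝ) ^ (1 / (τ - 1)) / Real.log (m n) →
      |1 - empCDF (S n) (w n) x - C * x ^ (1 - τ)| ≤ ε * (C * x ^ (1 - τ)))
    (hmax : ∀ ε : ℝ, 0 < ε → ∀ᶠ n : ℕ in atTop, ∀ i ∈ S n, w n i ≤ (m n : ℝ) ^ (1 / (τ - 1) + ε)) :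
    ∃ D : ℝ, 0 ≤ D ∧ ∀ᶠ n in atTop, ∀ x, w₀ ≤ x →
      (((S n).filter fun i => x < w n i).card : ℝ) ≤ D * (S n).card * x ^ (-β) := by
  have hτ1 : 0 < τ - 1 := by linarith
  have hgap : 0 < 1 - β / (τ - 1) := by
    rw [sub_pos, div_lt_one hτ1]
    exact hβ
  -- Chosen so that `m x ^ (-β) ≥ m ^ η` with `η > 0` for all `x` up to the maximal weight bound `m
  -- ^ (1/(τ-1) + ε)`.
  set ε := (1 - β / (τ - 1)) / (2 * β) with hε
  have hε0 : 0 < ε := by positivity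
  set η := (1 - β / (τ - 1)) / 2 with hη
  have hη0 : 0 < η := by positivity
  have hεη : 1 - β * (1 / (τ - 1) + ε) = η := by
    rw [hε, hη]
    field_simp
    ring
  have hmR : Tendsto (fun n => (m n : ℝ)) atTop atTop := tendsto_natCast_atTop_atTop.comp hm
  have hlog : ∀ᶠ x : ℝ in atTop, Real.log x ^ (τ - 1) ≤ x ^ η := by
    filter_upwards [(isLittleO_log_rpow_rpow_atTop (τ - 1) hη0).bound one_pos, eventually_ge_atTop 1]
      with x hx hx1
    rw [one_mul, Real.norm_of_nonneg (Real.rpow_nonneg (Real.log_nonneg hx1) _),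
      Real.norm_of_nonneg (Real.rpow_nonneg (by linarith) _)] at hx
    exact hx
  have hlarge : ∀ᶠ x : ℝ in atTop, w₀ ≤ x ^ (1 / (τ - 1)) / Real.log x := by
    filter_upwards [(isLittleO_log_rpow_atTop (r := 1 / (τ - 1)) (by positivity)).bound
      (inv_pos.2 hw₀), eventually_gt_atTop 1] with x hx hx1
    rw [Real.norm_of_nonneg (Real.log_nonneg hx1.le),
      Real.norm_of_nonneg (Real.rpow_nonneg (by linarith) _)] at hx
    rw [le_div_iff₀ (Real.log_pos hx1)]
    calc w₀ * Real.log x ≤ w₀ * (w₀⁻¹ * x ^ (1 / (τ - 1))) := by gcongr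
      _ = _ := by field_simp
  refine ⟨2 * C * w₀ ^ (β + 1 - τ) + 2 * C, by positivity, ?_⟩
  filter_upwards [hS, hF 1 one_pos, hmax ε hε0, hmR.eventually hlog, hmR.eventually hlarge,
    hmR.eventually_gt_atTop 1] with n hSn hFn hmaxn hlogn hlargen hmn x hx
  have hm0 : (0 : ℝ) < m n := by linarith
  have hScard : 0 < (S n).card := by
    rw [hSn]
    exact_mod_cast hm0
  have hx0 : 0 < x := hw₀.trans_le hx
  have hupper : ∀ y, w₀ ≤ y → y ≤ (m n : ℝ) ^ (1 / (τ - 1)) / Real.log (m n) →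
      (((S n).filter fun i => y < w n i).card : ℝ) ≤ m n * (2 * C * y ^ (1 - τ)) := by
    intro y hy hyL
    rw [card_filter_lt_eq hScard, hSn]
    have := (abs_le.1 (hFn y hy hyL)).2
    refine mul_le_mul_of_nonneg_left ?_ hm0.le
    linarith
  rw [hSn]
  have hxβ : 0 < x ^ (-β) := Real.rpow_pos_of_pos hx0 _
  rcases le_or_gt x ((m n : ℝ) ^ (1 / (τ - 1)) / Real.log (m n)) with hxL | hxL
  · refine (hupper x hx hxL).trans ?_
    have h1 : x ^ (1 - τ) = x ^ (β + 1 - τ) * x ^ (-β) := by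
      rw [← Real.rpow_add hx0]
      congr 1
      ring
    have h2 : x ^ (β + 1 - τ) ≤ w₀ ^ (β + 1 - τ) :=
      Real.rpow_le_rpow_of_nonpos hw₀ hx (by linarith)
    calc m n * (2 * C * x ^ (1 - τ)) = 2 * C * x ^ (β + 1 - τ) * m n * x ^ (-β) := by
          rw [h1]
          ring
      _ ≤ (2 * C * w₀ ^ (β + 1 - τ) + 2 * C) * m n * x ^ (-β) := by
          gcongr
          nlinarith
  -- Beyond the range of the tail hypothesis, the count is zero above the maximal weight. In
  -- between, monotonicity bounds it by its value at the end of the range, a power of `log m`, hence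
  -- `O(m ^ η)`.
  · rcases le_or_gt ((m n : ℝ) ^ (1 / (τ - 1) + ε)) x with hxm | hxm
    · have : (S n).filter (fun i => x < w n i) = ∅ := by
        refine Finset.filter_eq_empty_iff.2 fun i hi => ?_
        exact not_lt.2 ((hmaxn i hi).trans hxm)
      rw [this]
      simp only [Finset.card_empty, Nat.cast_zero]
      positivity
    · have hlm : 0 < Real.log (m n) := Real.log_pos hmn
      have hmono : (((S n).filter fun i => x < w n i).card : ℝ) ≤
          ((S n).filter fun i => (m n : ℝ) ^ (1 / (τ - 1)) / Real.log (m n) < w n i).card := by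
        exact_mod_cast Finset.card_le_card
          (Finset.monotone_filter_right _ fun i _ hi => hxL.trans hi)
      have hL : (m n : ℝ) * (2 * C * ((m n : ℝ) ^ (1 / (τ - 1)) / Real.log (m n)) ^ (1 - τ))
          = 2 * C * Real.log (m n) ^ (τ - 1) := by
        rw [Real.div_rpow (by positivity) hlm.le, ← Real.rpow_mul hm0.le,
          show 1 / (τ - 1) * (1 - τ) = -1 by field_simp; ring,
          show 1 - τ = -(τ - 1) by ring, Real.rpow_neg hlm.le, Real.rpow_neg_one]
        field_simp
      have hxβ' : (m n : ℝ) ^ (-(β * (1 / (τ - 1) + ε))) ≤ x ^ (-β) := by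
        have := Real.rpow_le_rpow_of_nonpos hx0 hxm.le (by linarith : -β ≤ 0)
        rw [← Real.rpow_mul hm0.le] at this
        convert this using 2
        ring
      have hmη : (m n : ℝ) ^ η = m n * (m n : ℝ) ^ (-(β * (1 / (τ - 1) + ε))) := by
        rw [← hεη, sub_eq_add_neg, Real.rpow_add hm0, Real.rpow_one]
      calc (((S n).filter fun i => x < w n i).card : ℝ)
          ≤ 2 * C * Real.log (m n) ^ (τ - 1) := hmono.trans ((hupper _ hlargen le_rfl).trans hL.le)
        _ ≤ 2 * C * (m n : ℝ) ^ η := by gcongr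
        _ ≤ 2 * C * (m n * x ^ (-β)) := by
            rw [hmη]
            gcongr
        _ ≤ (2 * C * w₀ ^ (β + 1 - τ) + 2 * C) * m n * x ^ (-β) := by
            have : 0 ≤ 2 * C * w₀ ^ (β + 1 - τ) * (m n * x ^ (-β)) := by positivity
            nlinarith

theorem eventually_sum_rpow_le {τ C w₀ s : ℝ} (hτ : 2 < τ) (hC : 0 < C) (hw₀ : 0 < w₀)
    (hs0 : 0 < s) (hs : s < τ - 1) {m : ℕ → ℕ} (hm : Tendsto m atTop atTop)
    {S : (n : ℕ) → Finset (Fin n)} (hS : ∀ᶠ n in atTop, (S n).card = m n) {w : (n : ℕ) → Fin n → ℝ}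
    (hw : ∀ n i, 0 < w n i)
    (hF : ∀ ε : ℝ, 0 < ε → ∀ᶠ n : ℕ in atTop, ∀ x : ℝ, w₀ ≤ x →
      x ≤ (m n : ℝ) ^ (1 / (τ - 1)) / Real.log (m n) →
      |1 - empCDF (S n) (w n) x - C * x ^ (1 - τ)| ≤ ε * (C * x ^ (1 - τ)))
    (hmax : ∀ ε : ℝ, 0 < ε → ∀ᶠ n : ℕ in atTop, ∀ i ∈ S n, w n i ≤ (m n : ℝ) ^ (1 / (τ - 1) + ε)) :
    ∃ M : ℝ, 0 ≤ M ∧ ∀ᶠ n in atTop, ∑ i ∈ S n, w n i ^ s ≤ M * m n := by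
  obtain ⟨β, hsβ, hβ⟩ := exists_between hs
  obtain ⟨D, hD, h⟩ := eventually_card_filter_lt_le hτ hC hw₀ (hs0.trans hsβ) hβ hm hS hF hmax
  have : 0 < β - s := by linarith
  refine ⟨w₀ ^ s + s * D * (w₀ ^ (s - β) / (β - s)), by positivity, ?_⟩
  filter_upwards [h, hS] with n hn hSn
  have := sum_rpow_le_of_tail (hw n) hw₀ hD hs0 hsβ hn
  rwa [hSn] at this

end Weights

/-! ### Consequences of the threshold window; detection inside the community -/

section Asymptotics

/-- Raising to the power `τ` gives `n log n / k ≤ k ^ (τ/(τ-1)) ≤ k ^ 2`, since `τ > 2`. The use is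
`log n ≤ 3 log k`. -/
theorem le_pow_three_of_threshold_le {τ : ℝ} (hτ : 2 < τ) {n k : ℕ} (hn : 3 ≤ n) (hk : 1 ≤ k)
    (h : ((n : ℝ) * Real.log n / k) ^ (1 / τ) ≤ (k : ℝ) ^ (1 / (τ - 1))) : (n : ℝ) ≤ (k : ℝ) ^ 3 := by
  have hk' : (1 : ℝ) ≤ k := by exact_mod_cast hk
  have hn' : (3 : ℝ) ≤ n := by exact_mod_cast hn
  have hlog : 1 ≤ Real.log n := by
    rw [Real.le_log_iff_exp_le (by linarith)]
    exact (Real.exp_one_lt_three.le).trans hn'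
  have hτ0 : 0 < τ := by linarith
  have hτ1 : 0 < τ - 1 := by linarith
  have h1 := Real.rpow_le_rpow (by positivity) h hτ0.le
  rw [← Real.rpow_mul (by positivity), one_div_mul_cancel hτ0.ne', Real.rpow_one,
    ← Real.rpow_mul (by positivity)] at h1
  have h2 : (k : ℝ) ^ (1 / (τ - 1) * τ) ≤ (k : ℝ) ^ (2 : ℝ) := by
    refine Real.rpow_le_rpow_of_exponent_le hk' ?_
    rw [one_div_mul_eq_div, div_le_iff₀ hτ1]
    linarith
  have h3 := h1.trans h2
  rw [Real.rpow_two, div_le_iff₀ (by positivity)] at h3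
  nlinarith

theorem eventually_le_pow_three {τ : ℝ} (hτ : 2 < τ) {k : ℕ → ℕ} {t : ℕ → ℝ}
    (hk : ∀ᶠ n in atTop, 1 ≤ k n ∧ k n ≤ n)
    (ht_low : (fun n : ℕ => ((n : ℝ) * Real.log n / k n) ^ (1 / τ)) =o[atTop] t)
    (ht_high : t =o[atTop] fun n : ℕ => (k n : ℝ) ^ (1 / (τ - 1))) :
    ∀ᶠ n : ℕ in atTop, (n : ℝ) ≤ (k n : ℝ) ^ 3 := by
  filter_upwards [hk, (ht_low.trans ht_high).bound one_pos, eventually_ge_atTop 3] with n hkn h hn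
  have hl : 0 ≤ Real.log n := Real.log_natCast_nonneg n
  rw [one_mul, Real.norm_of_nonneg (by positivity), Real.norm_of_nonneg (by positivity)] at h
  exact le_pow_three_of_threshold_le hτ hn hkn.1 h

theorem tendsto_of_le_pow_three {k : ℕ → ℕ} (h : ∀ᶠ n : ℕ in atTop, (n : ℝ) ≤ (k n : ℝ) ^ 3) :
    Tendsto k atTop atTop := by
  refine tendsto_atTop.2 fun b => ?_
  filter_upwards [h, eventually_gt_atTop (b ^ 3)] with n hn hb
  have h1 : n ≤ k n ^ 3 := by exact_mod_cast hn
  exact (lt_of_pow_lt_pow_left₀ 3 (Nat.zero_le _) (hb.trans_le h1)).le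

theorem tendsto_threshold {τ : ℝ} (hτ : 2 < τ) {k : ℕ → ℕ} {t : ℕ → ℝ}
    (hk : ∀ᶠ n in atTop, 1 ≤ k n ∧ k n ≤ n) (ht : ∀ᶠ n in atTop, 0 < t n)
    (ht_low : (fun n : ℕ => ((n : ℝ) * Real.log n / k n) ^ (1 / τ)) =o[atTop] t) :
    Tendsto t atTop atTop := by
  have hτ0 : 0 < 1 / τ := by
    have : 0 < τ := by linarith
    positivity
  have hlog : Tendsto (fun n : ℕ => Real.log n ^ (1 / τ)) atTop atTop :=
    (tendsto_rpow_atTop hτ0).comp (Real.tendsto_log_atTop.comp tendsto_natCast_atTop_atTop)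
  refine tendsto_atTop_mono' _ ?_ hlog
  filter_upwards [hk, ht, ht_low.bound one_pos] with n hkn htn h
  have hl : 0 ≤ Real.log n := Real.log_natCast_nonneg n
  rw [one_mul, Real.norm_of_nonneg (by positivity), Real.norm_of_nonneg htn.le] at h
  refine le_trans (Real.rpow_le_rpow hl ?_ hτ0.le) h
  have hk0 : (0 : ℝ) < k n := by exact_mod_cast hkn.1
  have hkn' : (k n : ℝ) ≤ n := by exact_mod_cast hkn.2
  rw [le_div_iff₀ hk0, mul_comm]
  gcongr

theorem eventually_le_rpow_div_log {τ : ℝ} (hτ : 2 < τ) (y : ℝ) {m : ℕ → ℕ}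
    (hm : Tendsto m atTop atTop) :
    ∀ᶠ n in atTop, y ≤ (m n : ℝ) ^ (1 / (τ - 1)) / Real.log (m n) := by
  have hmR : Tendsto (fun n => (m n : ℝ)) atTop atTop := tendsto_natCast_atTop_atTop.comp hm
  have hτ1 : 0 < 1 / (τ - 1) := one_div_pos.2 (by linarith)
  have hy : 0 < max y 1 := lt_max_of_lt_right one_pos
  refine hmR.eventually (p := fun x : ℝ => y ≤ x ^ (1 / (τ - 1)) / Real.log x) ?_
  filter_upwards [(isLittleO_log_rpow_atTop hτ1).bound (inv_pos.2 hy), eventually_gt_atTop 1]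
    with x hx hx1
  rw [Real.norm_of_nonneg (Real.log_nonneg hx1.le),
    Real.norm_of_nonneg (Real.rpow_nonneg (by linarith) _)] at hx
  refine (le_max_left y 1).trans ?_
  rw [le_div_iff₀ (Real.log_pos hx1)]
  calc max y 1 * Real.log x ≤ max y 1 * ((max y 1)⁻¹ * x ^ (1 / (τ - 1))) := by gcongr
    _ = _ := by field_simp

/-- A positive proportion of the community has weight in `(w₀, 2 w₀]`. -/
theorem eventually_card_band_ge {τ C w₀ : ℝ} (hτ : 2 < τ) (hC : 0 < C) (hw₀ : 0 < w₀)
    {m : ℕ → ℕ} (hm : Tendsto m atTop atTop)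
    {S : (n : ℕ) → Finset (Fin n)} (hS : ∀ᶠ n in atTop, (S n).card = m n) {w : (n : ℕ) → Fin n → ℝ}
    (hF : ∀ ε : ℝ, 0 < ε → ∀ᶠ n : ℕ in atTop, ∀ x : ℝ, w₀ ≤ x →
      x ≤ (m n : ℝ) ^ (1 / (τ - 1)) / Real.log (m n) →
      |1 - empCDF (S n) (w n) x - C * x ^ (1 - τ)| ≤ ε * (C * x ^ (1 - τ))) :
    ∃ c : ℝ, 0 < c ∧ ∀ᶠ n in atTop,
      c * m n ≤ (((S n).filter fun i => w₀ < w n i ∧ w n i ≤ 2 * w₀).card : ℝ) := by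
  -- Doubling the argument at least halves the tail, as `τ > 2`; the relative errors `1/8` leave
  -- `1/2 - 3/16 > 1/4` of `C w₀ ^ (1 - τ)`.
  refine ⟨C * w₀ ^ (1 - τ) / 4, by positivity, ?_⟩
  filter_upwards [hS, hF (1 / 8) (by norm_num), eventually_le_rpow_div_log hτ (2 * w₀) hm,
    hm.eventually_gt_atTop 0] with n hSn hFn hL hmn
  have hm0 : (0 : ℝ) < m n := by exact_mod_cast hmn
  have hScard : 0 < (S n).card := hSn ▸ hmn
  have h1 := (abs_le.1 (hFn w₀ le_rfl (by linarith))).1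
  have h2 := (abs_le.1 (hFn (2 * w₀) (by linarith) hL)).2
  have hpow : (2 * w₀) ^ (1 - τ) ≤ w₀ ^ (1 - τ) / 2 := by
    rw [Real.mul_rpow (by norm_num) hw₀.le]
    have : (2 : ℝ) ^ (1 - τ) ≤ 2 ^ (-1 : ℝ) :=
      Real.rpow_le_rpow_of_exponent_le (by norm_num) (by linarith)
    rw [Real.rpow_neg_one] at this
    have h3 : 0 < w₀ ^ (1 - τ) := Real.rpow_pos_of_pos hw₀ _
    nlinarith
  have hsplit : ((S n).filter fun i => w₀ < w n i).card ≤
      ((S n).filter fun i => w₀ < w n i ∧ w n i ≤ 2 * w₀).card +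
        ((S n).filter fun i => 2 * w₀ < w n i).card := by
    refine le_trans (Finset.card_le_card fun i hi => ?_) (Finset.card_union_le _ _)
    simp only [Finset.mem_union, Finset.mem_filter] at hi ⊢
    rcases le_or_gt (w n i) (2 * w₀) with h | h
    · exact Or.inl ⟨hi.1, hi.2, h⟩
    · exact Or.inr ⟨hi.1, h⟩
  have hsplit' : (((S n).filter fun i => w₀ < w n i).card : ℝ) ≤
      ((S n).filter fun i => w₀ < w n i ∧ w n i ≤ 2 * w₀).card +
        ((S n).filter fun i => 2 * w₀ < w n i).card := by exact_mod_cast hsplit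
  rw [card_filter_lt_eq hScard, card_filter_lt_eq hScard, hSn] at hsplit'
  have hX : C * (2 * w₀) ^ (1 - τ) ≤ C * w₀ ^ (1 - τ) / 2 := by nlinarith
  have hX0 : 0 < C * w₀ ^ (1 - τ) := by positivity
  have hdiff : C * w₀ ^ (1 - τ) / 4 ≤
      (1 - empCDF (S n) (w n) w₀) - (1 - empCDF (S n) (w n) (2 * w₀)) := by linarith
  have := mul_le_mul_of_nonneg_right hdiff hm0.le
  linarith

theorem exists_disjoint_halves {α : Type*} [DecidableEq α] {B : Finset α} (hB : 2 ≤ B.card) :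
    ∃ (N : ℕ) (B₁ B₂ : Finset α), 1 ≤ N ∧ (B.card : ℝ) / 4 ≤ N ∧ N ≤ B.card ∧ B₁ ∪ B₂ ⊆ B ∧
      Disjoint B₁ B₂ ∧ B₁.card = N ∧ B₂.card = N := by
  obtain ⟨B₁, hB₁, hc₁⟩ := Finset.exists_subset_card_eq (s := B) (n := B.card / 2) (by omega)
  obtain ⟨B₂, hB₂, hc₂⟩ := Finset.exists_subset_card_eq (s := B \ B₁) (n := B.card / 2) (by
    rw [Finset.card_sdiff_of_subset hB₁]
    omega)
  refine ⟨B.card / 2, B₁, B₂, by omega, ?_, by omega,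
    Finset.union_subset hB₁ (hB₂.trans Finset.sdiff_subset), ?_, hc₁, hc₂⟩
  · have : B.card ≤ 4 * (B.card / 2) := by omega
    have : (B.card : ℝ) ≤ 4 * ((B.card / 2 : ℕ) : ℝ) := by exact_mod_cast this
    linarith
  · exact Finset.disjoint_of_subset_right hB₂ Finset.disjoint_sdiff

/-- Heavy vertices of the community are missed with a probability that is uniformly of the order
of the reciprocal of their weight. -/
theorem eventually_volume_notMem_estimatedCommunity_le {d : ℕ} (hd : 1 ≤ d) (γ : ℝ≥0∞)
    {τ C w₀ : ℝ} (hτ : 2 < τ) (hC : 0 < C) (hw₀ : 0 < w₀) {k : ℕ → ℕ} {w : (n : ℕ) → Fin n → ℝ}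
    (hk : ∀ᶠ n in atTop, 1 ≤ k n ∧ k n ≤ n) (hw : ∀ n i, 0 < w n i)
    (hk_top : Tendsto k atTop atTop)
    (hF : ∀ ε : ℝ, 0 < ε → ∀ᶠ n : ℕ in atTop, ∀ x : ℝ, w₀ ≤ x →
      x ≤ (k n : ℝ) ^ (1 / (τ - 1)) / Real.log (k n) →
      |1 - empCDF (community n (k n)) (w n) x - C * x ^ (1 - τ)| ≤ ε * (C * x ^ (1 - τ)))
    (hmax : ∀ ε : ℝ, 0 < ε → ∀ᶠ n : ℕ in atTop, ∀ i ∈ community n (k n),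
      w n i ≤ (k n : ℝ) ^ (1 / (τ - 1) + ε)) :
    ∃ K : ℝ, 0 ≤ K ∧ ∀ᶠ n in atTop, ∀ a ∈ community n (k n), 2 * w₀ < w n a →
      volume.real {ω : Sample d n |
        a ∉ estimatedCommunity (w n) (randomGraph d τ w₀ γ (k n) (w n) ω)} ≤ K / w n a := by
  have hμ := meanWeight_pos hτ hw₀
  set μ := meanWeight τ w₀ with hμdef
  have hq0 := retention_pos d γ
  set q := retention d γ with hq
  have hcard : ∀ᶠ n in atTop, (community n (k n)).card = k n :=
    hk.mono fun n hn => card_community hn.2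
  obtain ⟨c, hc, hband⟩ := eventually_card_band_ge hτ hC hw₀ hk_top hcard hF
  have hkR : Tendsto (fun n => (k n : ℝ)) atTop atTop := tendsto_natCast_atTop_atTop.comp hk_top
  have hτ1 : 0 < τ - 1 := by linarith
  have hε : 0 < (1 - 1 / (τ - 1)) / 2 := by
    have : 1 / (τ - 1) < 1 := by
      rw [div_lt_one hτ1]
      linarith
    linarith
  -- Half of the gap below `1`: community weights are at most `k ^ (1 - ε) = o(k)`, so `α ≤ 1` and
  -- the balls do not wrap around the torus.
  set ε := (1 - 1 / (τ - 1)) / 2 with hεdef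
  have hexp : 1 / (τ - 1) + ε = 1 + -ε := by
    rw [hεdef]
    ring
  have hkε : ∀ᶠ n in atTop, (k n : ℝ) ^ (-ε) ≤ μ / w₀ :=
    (((tendsto_rpow_neg_atTop hε).comp hkR).eventually_lt_const (by positivity)).mono
      fun n hn => hn.le
  -- The lower bound for `N ^ 2 α β / w_a` obtained from `N ≥ c k / 4`.
  set A := (c / 4) ^ 2 * w₀ ^ 3 / μ ^ 2 with hA
  have hA0 : 0 < A := by positivity
  have hlogtop : Tendsto (fun n : ℕ => Real.sqrt (Real.log n)) atTop atTop :=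
    Real.tendsto_sqrt_atTop.comp (Real.tendsto_log_atTop.comp tendsto_natCast_atTop_atTop)
  refine ⟨4 * (2 * w₀ ^ 2 / μ + 1) / (A * q ^ 6), by positivity, ?_⟩
  filter_upwards [hk, hcard, hband, hmax ε hε, hkε, eventually_ge_atTop 2,
    hlogtop.eventually_ge_atTop ((2 * w₀) ^ 2 * 2 / (A * q ^ 3)),
    hlogtop.eventually_gt_atTop 0, (hkR.const_mul_atTop hc).eventually_ge_atTop 2]
    with n hkn hcardn hbandn hmaxn hkεn hn hlogn hlog0 hck a ha hwa
  have hk0 : (0 : ℝ) < k n := by exact_mod_cast hkn.1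
  have hwa0 := hw n a
  obtain ⟨N, B₁, B₂, hN1, hNlow, hNup, hsub, hdisj, hc₁, hc₂⟩ := exists_disjoint_halves
    (B := (community n (k n)).filter fun i => w₀ < w n i ∧ w n i ≤ 2 * w₀)
    (by exact_mod_cast hck.trans hbandn)
  have hNlow' : c / 4 * k n ≤ N := by linarith
  have hNk : (N : ℝ) ≤ k n := by
    have := hNup.trans (Finset.card_filter_le _ _)
    rw [hcardn] at this
    exact_mod_cast this
  have hN0 : (0 : ℝ) < N := by exact_mod_cast hN1
  set α := w n a * w₀ / (μ * k n) with hα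
  set β := w₀ * w₀ / (μ * k n) with hβ
  have hα0 : 0 < α := by positivity
  have hβ0 : 0 < β := by positivity
  have hα1 : α ≤ 1 := by
    rw [hα, div_le_one (by positivity)]
    have h1 := hmaxn a ha
    rw [hexp, Real.rpow_add hk0, Real.rpow_one] at h1
    calc w n a * w₀ ≤ k n * (μ / w₀) * w₀ := by
          gcongr
          exact h1.trans (by gcongr)
      _ = μ * k n := by field_simp
  have hNαβ : A * w n a ≤ N ^ 2 * (α * β) := by
    calc A * w n a = (c / 4 * k n) ^ 2 * (α * β) := by
          rw [hA, hα, hβ]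
          field_simp
      _ ≤ _ := by gcongr
  have hNβ : N * β ≤ w₀ ^ 2 / μ := by
    calc N * β ≤ k n * β := by gcongr
      _ = _ := by
        rw [hβ]
        field_simp
  have hmain := volume_notMem_estimatedCommunity_le (γ := γ) hd hτ hw₀ hkn.1 hn (hw n) ha
    (by linarith) (R := 2 * w₀) (by positivity) hN1 (fun b hb => by
      have := Finset.mem_filter.1 (hsub hb)
      refine ⟨this.1, this.2.1.le, this.2.2, ?_⟩
      rintro rfl
      linarith [this.2.2]) hdisj hc₁ hc₂ hα hβ hq hα1 (by
      rw [div_le_iff₀ (by positivity)] at hlogn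
      calc (2 * w₀) ^ 2 * (w n a / Real.sqrt (Real.log n))
          = (2 * w₀) ^ 2 * 2 * (w n a / Real.sqrt (Real.log n)) / 2 := by ring
        _ ≤ Real.sqrt (Real.log n) * (A * q ^ 3) * (w n a / Real.sqrt (Real.log n)) / 2 := by
            gcongr
        _ = A * w n a * q ^ 3 / 2 := by field_simp
        _ ≤ N ^ 2 * (α * β) * q ^ 3 / 2 := by gcongr
        _ = _ := by ring)
  refine hmain.trans ?_
  -- Since `N β` is bounded, numerator and mean are both of order `N ^ 2 α β`, itself at least `A
  -- w_a`; one factor survives in the denominator.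
  calc 4 * (2 * N ^ 3 * (α * β ^ 2) + N ^ 2 * (α * β)) / (N ^ 2 * (α * β * q ^ 3)) ^ 2
      = 4 * (2 * (N * β) + 1) / (N ^ 2 * (α * β) * q ^ 6) := by field_simp
    _ ≤ 4 * (2 * (w₀ ^ 2 / μ) + 1) / (A * w n a * q ^ 6) := by gcongr
    _ = _ := by field_simp

theorem measurableSet_mem_estimatedCommunity (d : ℕ) (τ w₀ : ℝ) (γ : ℝ≥0∞) {n : ℕ} (k : ℕ)
    (w : Fin n → ℝ) (a : Fin n) : MeasurableSet
      {ω : Sample d n | a ∈ estimatedCommunity w (randomGraph d τ w₀ γ k w ω)} := by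
  simp only [mem_estimatedCommunity]
  refine measurableSet_lt measurable_const (Measurable.const_mul ?_ _)
  exact Finset.measurable_sum _ fun b _ => Finset.measurable_sum _ fun c _ =>
    Measurable.ite (measurableSet_triangle d τ w₀ γ k w a b c) measurable_const measurable_const

/-- The symmetric difference splits into missed members and false reports; expectation is linear. -/
theorem risk_eq (d : ℕ) (τ w₀ : ℝ) (γ : ℝ≥0∞) {n : ℕ} (k : ℕ) (w : Fin n → ℝ) (t : ℝ) :
    risk d τ w₀ γ k w t =
      (∑ a ∈ heavy w (community n k) t, volume.real
          {ω : Sample d n | a ∉ estimatedCommunity w (randomGraph d τ w₀ γ k w ω)} +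
        ∑ a ∈ heavy w (Finset.univ \ community n k) t, volume.real
          {ω : Sample d n | a ∈ estimatedCommunity w (randomGraph d τ w₀ γ k w ω)}) /
      (2 * ((heavy w (community n k) t).card : ℝ)) := by
  set E : Fin n → Set (Sample d n) := fun a =>
    {ω | a ∈ estimatedCommunity w (randomGraph d τ w₀ γ k w ω)} with hE
  have hm : ∀ a, MeasurableSet (E a) := measurableSet_mem_estimatedCommunity d τ w₀ γ k w
  have hi : ∀ s : Set (Sample d n), MeasurableSet s →
      Integrable (s.indicator fun _ => (1 : ℝ)) volume := fun s hs =>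
    (integrable_const 1).indicator hs
  have hcard : ∀ ω : Sample d n,
      ((symmDiff (heavy w (estimatedCommunity w (randomGraph d τ w₀ γ k w ω)) t)
        (heavy w (community n k) t)).card : ℝ) =
      ∑ a ∈ heavy w (community n k) t, (E a)ᶜ.indicator (fun _ => (1 : ℝ)) ω +
        ∑ a ∈ heavy w (Finset.univ \ community n k) t, (E a).indicator (fun _ => (1 : ℝ)) ω := by
    intro ω
    have hunion : symmDiff (heavy w (estimatedCommunity w (randomGraph d τ w₀ γ k w ω)) t)
        (heavy w (community n k) t) =
        ((heavy w (community n k) t).filter fun a => ω ∈ (E a)ᶜ) ∪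
          ((heavy w (Finset.univ \ community n k) t).filter fun a => ω ∈ E a) := by
      ext a
      simp only [Finset.mem_symmDiff, heavy, Finset.mem_filter, Finset.mem_union, Finset.mem_sdiff,
        Finset.mem_univ, true_and, Set.mem_compl_iff, hE, Set.mem_ofPred_eq]
      tauto
    have hdisj : Disjoint ((heavy w (community n k) t).filter fun a => ω ∈ (E a)ᶜ)
        ((heavy w (Finset.univ \ community n k) t).filter fun a => ω ∈ E a) := by
      rw [Finset.disjoint_left]
      intro a ha ha'
      exact (Finset.mem_filter.1 ha).2 (Finset.mem_filter.1 ha').2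
    rw [hunion, Finset.card_union_of_disjoint hdisj, Nat.cast_add,
      Finset.natCast_card_filter, Finset.natCast_card_filter]
    congr 1 <;> refine Finset.sum_congr rfl fun a _ => ?_ <;> by_cases h : ω ∈ E a <;> simp [h]
  have hsum1 := fun (U : Finset (Fin n)) (F : Fin n → Set (Sample d n))
      (hF : ∀ a, MeasurableSet (F a)) =>
    integrable_finsetSum U fun a _ => hi (F a) (hF a)
  have hint : ∀ (U : Finset (Fin n)) (F : Fin n → Set (Sample d n)) (_ : ∀ a, MeasurableSet (F a)),
      ∫ ω, ∑ a ∈ U, (F a).indicator (fun _ => (1 : ℝ)) ω = ∑ a ∈ U, volume.real (F a) := by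
    intro U F hF
    rw [integral_finsetSum _ fun a _ => hi _ (hF a)]
    refine Finset.sum_congr rfl fun a _ => ?_
    rw [integral_indicator_const _ (hF a), smul_eq_mul, mul_one]
  unfold risk
  rw [integral_div]
  congr 1
  simp only [hcard]
  rw [integral_add (hsum1 _ _ fun a => (hm a).compl) (hsum1 _ _ hm),
    hint _ _ fun a => (hm a).compl, hint _ _ hm]
  rfl

end Asymptotics

/-! ### Comparing false reports with the heavy vertices of the community -/

section Main

/-- In this range `m t ^ (1 - τ) ≥ (log m) ^ (τ - 1) ≥ log m`, the last step because `τ > 2`. -/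
theorem card_heavy_ge {τ C w₀ : ℝ} (hτ : 2 < τ) (hC : 0 < C) (hw₀ : 0 < w₀) {n m : ℕ}
    {S : Finset (Fin n)} (hS : S.card = m) (hm : 1 ≤ Real.log m) {w : Fin n → ℝ} {t : ℝ}
    (ht : w₀ ≤ t) (htL : t ≤ (m : ℝ) ^ (1 / (τ - 1)) / Real.log m)
    (hF : |1 - empCDF S w t - C * t ^ (1 - τ)| ≤ 1 / 2 * (C * t ^ (1 - τ))) :
    C / 2 * Real.log m ≤ ((heavy w S t).card : ℝ) := by
  have hτ1 : 0 < τ - 1 := by linarith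
  have ht0 : 0 < t := hw₀.trans_le ht
  have hm0 : 0 < m := Nat.pos_of_ne_zero fun h => by
    rw [h] at hm
    norm_num at hm
  have hm0' : (0 : ℝ) < m := by exact_mod_cast hm0
  have hl : 0 < Real.log m := by linarith
  have hsub : (S.filter fun i => t < w i).card ≤ (heavy w S t).card :=
    Finset.card_le_card (Finset.monotone_filter_right _ fun i _ hi => le_of_lt hi)
  have h1 := (abs_le.1 hF).1
  have h2 : (Real.log m) ≤ m * t ^ (1 - τ) := by
    calc Real.log m = Real.log m ^ (1 : ℝ) := (Real.rpow_one _).symm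
      _ ≤ Real.log m ^ (τ - 1) := Real.rpow_le_rpow_of_exponent_le hm (by linarith)
      _ = m * ((m : ℝ) ^ (1 / (τ - 1)) / Real.log m) ^ (1 - τ) := by
        rw [Real.div_rpow (by positivity) hl.le, ← Real.rpow_mul hm0'.le,
          show 1 / (τ - 1) * (1 - τ) = -1 by field_simp; ring,
          show 1 - τ = -(τ - 1) by ring, Real.rpow_neg hl.le, Real.rpow_neg_one]
        field_simp
      _ ≤ m * t ^ (1 - τ) :=
        mul_le_mul_of_nonneg_left (Real.rpow_le_rpow_of_nonpos ht0 htL (by linarith)) hm0'.le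
  calc C / 2 * Real.log m ≤ C / 2 * (m * t ^ (1 - τ)) := by gcongr
    _ = m * (1 / 2 * (C * t ^ (1 - τ))) := by ring
    _ ≤ m * (1 - empCDF S w t) := by
        gcongr
        linarith
    _ = (S.filter fun i => t < w i).card := by rw [card_filter_lt_eq (hS ▸ hm0), hS]
    _ ≤ _ := by exact_mod_cast hsub

theorem eventually_log_le_rpow {τ δ : ℝ} (hτ : 2 < τ) (hδ : 0 < δ) :
    ∀ᶠ x : ℝ in atTop, Real.log x ≤ (x ^ (1 / (τ - 1)) / Real.log x) ^ δ := by
  have hτ1 : 0 < τ - 1 := by linarith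
  filter_upwards [(isLittleO_log_rpow_rpow_atTop (1 + δ)
    (show 0 < 1 / (τ - 1) * δ by positivity)).bound one_pos, eventually_gt_atTop 1] with x hx hx1
  have hl := Real.log_pos hx1
  have hx0 : 0 < x := by linarith
  rw [one_mul, Real.norm_of_nonneg (by positivity), Real.norm_of_nonneg (by positivity),
    Real.rpow_add hl, Real.rpow_one] at hx
  rw [Real.div_rpow (by positivity) hl.le, ← Real.rpow_mul hx0.le, le_div_iff₀ (by positivity)]
  exact hx

/-- The expected number of heavy vertices outside the community that are wrongly reported is of
smaller order than the number of heavy vertices of the community. -/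
theorem eventually_sum_outside_le {d : ℕ} (hd : 1 ≤ d) {γ : ℝ≥0∞} (hγ : 1 < γ)
    {τ C w₀ : ℝ} (hτ : 2 < τ) (hC : 0 < C) (hw₀ : 0 < w₀) {k : ℕ → ℕ} {w : (n : ℕ) → Fin n → ℝ}
    {t : ℕ → ℝ} (hk : ∀ᶠ n in atTop, 1 ≤ k n ∧ k n ≤ n) (hw : ∀ n i, 0 < w n i)
    (hk3 : ∀ᶠ n : ℕ in atTop, (n : ℝ) ≤ (k n : ℝ) ^ 3) (ht_top : Tendsto t atTop atTop)
    (hF : ∀ ε : ℝ, 0 < ε → ∀ᶠ n : ℕ in atTop, ∀ x : ℝ, w₀ ≤ x →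
      x ≤ (n : ℝ) ^ (1 / (τ - 1)) / Real.log n →
      |1 - empCDF Finset.univ (w n) x - C * x ^ (1 - τ)| ≤ ε * (C * x ^ (1 - τ)))
    (hFk : ∀ ε : ℝ, 0 < ε → ∀ᶠ n : ℕ in atTop, ∀ x : ℝ, w₀ ≤ x →
      x ≤ (k n : ℝ) ^ (1 / (τ - 1)) / Real.log (k n) →
      |1 - empCDF (community n (k n)) (w n) x - C * x ^ (1 - τ)| ≤ ε * (C * x ^ (1 - τ)))
    (hmax : ∀ ε : ℝ, 0 < ε → ∀ᶠ n : ℕ in atTop, ∀ i : Fin n,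
      w n i ≤ (n : ℝ) ^ (1 / (τ - 1) + ε))
    (hmaxk : ∀ ε : ℝ, 0 < ε → ∀ᶠ n : ℕ in atTop, ∀ i ∈ community n (k n),
      w n i ≤ (k n : ℝ) ^ (1 / (τ - 1) + ε)) :
    ∃ K : ℝ, 0 ≤ K ∧ ∀ᶠ n : ℕ in atTop, (heavy (w n) (community n (k n)) (t n)).Nonempty →
      ∑ a ∈ heavy (w n) (Finset.univ \ community n (k n)) (t n), volume.real {ω : Sample d n |
        a ∈ estimatedCommunity (w n) (randomGraph d τ w₀ γ (k n) (w n) ω)} ≤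
      K / Real.sqrt (Real.log n) * ((heavy (w n) (community n (k n)) (t n)).card : ℝ) := by
  have hμ := meanWeight_pos hτ hw₀
  have hk_top := tendsto_of_le_pow_three hk3
  have hkR : Tendsto (fun n => (k n : ℝ)) atTop atTop := tendsto_natCast_atTop_atTop.comp hk_top
  have hcard : ∀ᶠ n in atTop, (community n (k n)).card = k n :=
    hk.mono fun n hn => card_community hn.2
  have hcardu : ∀ᶠ n in atTop, (Finset.univ : Finset (Fin n)).card = id n :=
    Eventually.of_forall fun n => by simp
  have hmax' : ∀ ε : ℝ, 0 < ε → ∀ᶠ n : ℕ in atTop, ∀ i ∈ (Finset.univ : Finset (Fin n)),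
      w n i ≤ (id n : ℝ) ^ (1 / (τ - 1) + ε) := fun ε hε =>
    (hmax ε hε).mono fun n hn i _ => hn i
  obtain ⟨M₁, hM₁, hsum₁⟩ := eventually_sum_rpow_le (s := 1) hτ hC hw₀ one_pos (by linarith)
    tendsto_id hcardu hw hF hmax'
  obtain ⟨M₂, hM₂, hsum₂⟩ := eventually_sum_rpow_le (s := 1) hτ hC hw₀ one_pos (by linarith)
    hk_top hcard hw hFk hmaxk
  -- With `1 + δ < τ - 1`, the moment of order `1 + δ` is still `O(n)`.
  obtain ⟨δ, hδ, hδτ⟩ := exists_between (show 0 < τ - 2 by linarith)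
  obtain ⟨M₃, hM₃, hsum₃⟩ := eventually_sum_rpow_le (s := 1 + δ) hτ hC hw₀ (by linarith)
    (by linarith) tendsto_id hcardu hw hF hmax'
  simp only [Real.rpow_one, id] at hsum₁ hsum₂ hsum₃
  set M := max M₁ M₂ with hMdef
  have hM : 0 ≤ M := hM₁.trans (le_max_left _ _)
  have hP := profileConst_nonneg d hγ
  set c₀ := (profileConst d γ + 1) * M ^ 2 / meanWeight τ w₀ ^ 3 with hc₀def
  have hc₀ : 0 ≤ c₀ := by positivity
  refine ⟨6 * c₀ * M / C + 3 * c₀ * M₃, by positivity, ?_⟩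
  filter_upwards [hk, hcard, hk3, hsum₁, hsum₂, hsum₃, hFk (1 / 2) (by norm_num),
    ht_top.eventually_ge_atTop w₀, eventually_ge_atTop 2,
    hkR.eventually (eventually_log_le_rpow hτ hδ), eventually_le_rpow_div_log hτ 1 hk_top,
    (Real.tendsto_log_atTop.comp hkR).eventually_ge_atTop 1]
    with n hkn hcardn hk3n h₁ h₂ h₃ hFkn htn hn hlogδ hone hlogk hne
  simp only [Function.comp_apply] at hlogk
  have hn0 : (0 : ℝ) < n := by exact_mod_cast (by omega : 0 < n)
  have hk0 : (0 : ℝ) < k n := by exact_mod_cast hkn.1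
  have hL0 : 0 < Real.log n := Real.log_pos (by exact_mod_cast (by omega : 1 < n))
  have hL3 : Real.log n ≤ 3 * Real.log (k n) := by
    have := Real.log_le_log hn0 hk3n
    rw [Real.log_pow] at this
    exact_mod_cast this
  have ht0 : 0 < t n := hw₀.trans_le htn
  set s := Real.sqrt (Real.log n) with hs
  have hs0 : 0 < s := Real.sqrt_pos.2 hL0
  have hss : s * s = Real.log n := Real.mul_self_sqrt hL0.le
  set h := ((heavy (w n) (community n (k n)) (t n)).card : ℝ) with hh
  have h1 : 1 ≤ h := by
    rw [hh]
    exact_mod_cast hne.card_pos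
  have hMn : ∑ i, w n i ≤ M * n := h₁.trans (by gcongr; exact le_max_left _ _)
  have hMk : ∑ i ∈ community n (k n), w n i ≤ M * k n := h₂.trans (by gcongr; exact le_max_right _ _)
  have hprob : ∑ a ∈ heavy (w n) (Finset.univ \ community n (k n)) (t n),
      volume.real {ω : Sample d n |
        a ∈ estimatedCommunity (w n) (randomGraph d τ w₀ γ (k n) (w n) ω)} ≤
      c₀ * s / n * ∑ a ∈ heavy (w n) (Finset.univ \ community n (k n)) (t n), w n a := by
    rw [Finset.mul_sum]
    refine Finset.sum_le_sum fun a ha => ?_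
    have ha' : a ∉ community n (k n) := (Finset.mem_sdiff.1 (Finset.mem_filter.1 ha).1).2
    have := hw n a
    refine ENNReal.toReal_le_of_le_ofReal (by positivity) ?_
    refine (volume_mem_estimatedCommunity_le hd hγ hτ hw₀ hkn.1 hkn.2 hn (hw n) hMn hMk
      ha').trans (ENNReal.ofReal_le_ofReal (le_of_eq ?_))
    rw [← hc₀def, ← hs]
    ring
  refine hprob.trans ?_
  -- Below the cutoff the community has at least `C / 6 * log n` heavy vertices. Above it, `t ^ δ ≥
  -- log n / 3` makes the outside weight sum `O(n / log n)`.
  rcases le_or_gt (t n) ((k n : ℝ) ^ (1 / (τ - 1)) / Real.log (k n)) with hcase | hcase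
  · have hheavy := card_heavy_ge hτ hC hw₀ hcardn hlogk htn hcase (hFkn _ htn hcase)
    have hhL : C / 6 * (s * s) ≤ h := by
      rw [hss]
      refine le_trans ?_ hheavy
      nlinarith
    have hsumM : ∑ a ∈ heavy (w n) (Finset.univ \ community n (k n)) (t n), w n a ≤ M * n :=
      (Finset.sum_le_univ_sum_of_nonneg fun i => (hw n i).le).trans hMn
    calc c₀ * s / n * ∑ a ∈ heavy (w n) (Finset.univ \ community n (k n)) (t n), w n a
        ≤ c₀ * s / n * (M * n) := by gcongr
      _ = 6 * c₀ * M / C / s * (C / 6 * (s * s)) := by field_simp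
      _ ≤ 6 * c₀ * M / C / s * h := by gcongr
      _ ≤ (6 * c₀ * M / C + 3 * c₀ * M₃) / s * h := by
          gcongr
          exact le_add_of_nonneg_right (by positivity)
  · have hlk : 0 < Real.log (k n) := by linarith
    have htδ : Real.log n / 3 ≤ t n ^ δ := by
      calc Real.log n / 3 ≤ Real.log (k n) := by linarith
        _ ≤ _ := hlogδ
        _ ≤ t n ^ δ := Real.rpow_le_rpow (by linarith) hcase.le hδ.le
    have hsumM : (∑ a ∈ heavy (w n) (Finset.univ \ community n (k n)) (t n), w n a) * t n ^ δ
        ≤ M₃ * n := by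
      refine le_trans ?_ ((Finset.sum_le_univ_sum_of_nonneg
        (s := heavy (w n) (Finset.univ \ community n (k n)) (t n))
        fun i => Real.rpow_nonneg (hw n i).le (1 + δ)).trans h₃)
      rw [Finset.sum_mul]
      refine Finset.sum_le_sum fun a ha => ?_
      have hta : t n ≤ w n a := (Finset.mem_filter.1 ha).2
      rw [Real.rpow_add (hw n a), Real.rpow_one]
      exact mul_le_mul_of_nonneg_left (Real.rpow_le_rpow ht0.le hta hδ.le) (hw n a).le
    have hsumM' : ∑ a ∈ heavy (w n) (Finset.univ \ community n (k n)) (t n), w n a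
        ≤ 3 * M₃ * n / (s * s) := by
      rw [hss, le_div_iff₀ hL0]
      have hpos : 0 ≤ ∑ a ∈ heavy (w n) (Finset.univ \ community n (k n)) (t n), w n a :=
        Finset.sum_nonneg fun i _ => (hw n i).le
      nlinarith [mul_le_mul_of_nonneg_left htδ hpos]
    calc c₀ * s / n * ∑ a ∈ heavy (w n) (Finset.univ \ community n (k n)) (t n), w n a
        ≤ c₀ * s / n * (3 * M₃ * n / (s * s)) := by gcongr
      _ = 3 * c₀ * M₃ / s * 1 := by field_simp
      _ ≤ 3 * c₀ * M₃ / s * h := by gcongr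
      _ ≤ (6 * c₀ * M / C + 3 * c₀ * M₃) / s * h := by
          gcongr
          exact le_add_of_nonneg_left (by positivity)

end Main

end GeomCommunity

theorem theorem3p2
    -- the fixed parameters of the model
    (d : ℕ) (hd : 1 ≤ d) (γ : ℝ≥0∞) (hγ : 1 < γ)
    (τ C w₀ : ℝ) (hτ : 2 < τ ∧ τ < 3) (hC : 0 < C) (hw₀ : 0 < w₀)
    -- the community sizes, the weight sequences and the thresholds
    (k : ℕ → ℕ) (w : (n : ℕ) → Fin n → ℝ) (t : ℕ → ℝ)
    (hk : ∀ᶠ n in atTop, 1 ≤ k n ∧ k n ≤ n)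
    (hw : ∀ n i, 0 < w n i)
    (ht : ∀ᶠ n in atTop, 0 < t n)
    -- power-law tail of the weights of all the vertices
    (hF : ∀ ε : ℝ, 0 < ε → ∀ᶠ n : ℕ in atTop, ∀ x : ℝ, w₀ ≤ x →
      x ≤ (n : ℝ) ^ (1 / (τ - 1)) / Real.log n →
      |1 - GeomCommunity.empCDF Finset.univ (w n) x - C * x ^ (1 - τ)| ≤ ε * (C * x ^ (1 - τ)))
    -- power-law tail of the weights in the community
    (hFk : ∀ K : ℝ, 0 < K → ∀ ε : ℝ, 0 < ε → ∀ᶠ n : ℕ in atTop, ∀ x : ℝ, w₀ ≤ x →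
      x ≤ K * ((k n : ℝ) ^ (1 / (τ - 1)) / Real.log (k n)) →
      |1 - GeomCommunity.empCDF (GeomCommunity.community n (k n)) (w n) x - C * x ^ (1 - τ)|
        ≤ ε * (C * x ^ (1 - τ)))
    -- the largest weights are at most `n ^ (1/(τ-1) + o(1))` and `k ^ (1/(τ-1) + o(1))`
    (hmax : ∀ ε : ℝ, 0 < ε → ∀ᶠ n : ℕ in atTop, ∀ i : Fin n,
      w n i ≤ (n : ℝ) ^ (1 / (τ - 1) + ε))
    (hmaxk : ∀ ε : ℝ, 0 < ε → ∀ᶠ n : ℕ in atTop, ∀ i ∈ GeomCommunity.community n (k n),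
      w n i ≤ (k n : ℝ) ^ (1 / (τ - 1) + ε))
    -- `(n log n / k) ^ (1/τ) ≪ t_n ≪ k ^ (1/(τ-1))`
    (ht_low : (fun n : ℕ => ((n : ℝ) * Real.log n / k n) ^ (1 / τ)) =o[atTop] t)
    (ht_high : t =o[atTop] fun n : ℕ => (k n : ℝ) ^ (1 / (τ - 1))) :
    Tendsto (fun n => GeomCommunity.risk d τ w₀ γ (k n) (w n) (t n))
      (atTop ⊓ 𝓟 {n | (GeomCommunity.heavy (w n)
        (GeomCommunity.community n (k n)) (t n)).Nonempty}) (𝓝 0) := by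
  obtain ⟨hτ2, -⟩ := hτ
  have hFk1 : ∀ ε : ℝ, 0 < ε → ∀ᶠ n : ℕ in atTop, ∀ x : ℝ, w₀ ≤ x →
      x ≤ (k n : ℝ) ^ (1 / (τ - 1)) / Real.log (k n) →
      |1 - GeomCommunity.empCDF (GeomCommunity.community n (k n)) (w n) x - C * x ^ (1 - τ)|
        ≤ ε * (C * x ^ (1 - τ)) := by
    intro ε hε
    simpa only [one_mul] using hFk 1 one_pos ε hε
  have hk3 := GeomCommunity.eventually_le_pow_three hτ2 hk ht_low ht_high
  have hk_top := GeomCommunity.tendsto_of_le_pow_three hk3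
  have ht_top := GeomCommunity.tendsto_threshold hτ2 hk ht ht_low
  obtain ⟨K₁, hK₁, h₁⟩ := GeomCommunity.eventually_volume_notMem_estimatedCommunity_le hd γ hτ2 hC
    hw₀ hk hw hk_top hFk1 hmaxk
  obtain ⟨K₂, hK₂, h₂⟩ := GeomCommunity.eventually_sum_outside_le hd hγ hτ2 hC hw₀ hk hw hk3 ht_top
    hF hFk1 hmax hmaxk
  have hlogtop : Tendsto (fun n : ℕ => Real.sqrt (Real.log n)) atTop atTop :=
    Real.tendsto_sqrt_atTop.comp (Real.tendsto_log_atTop.comp tendsto_natCast_atTop_atTop)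
  -- The two terms bound the proportions of missed members and of false reports relative to the
  -- heavy community.
  have hlim : Tendsto (fun n : ℕ => (K₁ / t n + K₂ / Real.sqrt (Real.log n)) / 2) atTop (𝓝 0) := by
    simpa using ((ht_top.const_div_atTop K₁).add (hlogtop.const_div_atTop K₂)).div_const 2
  refine tendsto_of_tendsto_of_tendsto_of_le_of_le' tendsto_const_nhds
    (hlim.mono_left inf_le_left) (Eventually.of_forall fun n => ?_) ?_
  · exact integral_nonneg fun ω => by positivity
  · rw [eventually_inf_principal]
    -- Eventually `t > 2 w₀`, so every heavy vertex lies above the band from which `b` and `c` are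
    -- drawn.
    filter_upwards [h₁, h₂, ht_top.eventually_gt_atTop (2 * w₀)] with n h₁n h₂n htn hne
    have hcard : (0 : ℝ) < (GeomCommunity.heavy (w n)
        (GeomCommunity.community n (k n)) (t n)).card := by exact_mod_cast hne.card_pos
    have ht0 : 0 < t n := by linarith
    rw [GeomCommunity.risk_eq, div_le_iff₀ (by positivity)]
    have hin := Finset.sum_le_card_nsmul (GeomCommunity.heavy (w n)
        (GeomCommunity.community n (k n)) (t n)) (fun a => volume.real
          {ω : GeomCommunity.Sample d n | a ∉ GeomCommunity.estimatedCommunity (w n)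
            (GeomCommunity.randomGraph d τ w₀ γ (k n) (w n) ω)}) (K₁ / t n) fun a ha => by
      obtain ⟨hac, hat⟩ := Finset.mem_filter.1 ha
      exact (h₁n a hac (htn.trans_le hat)).trans (by gcongr)
    rw [nsmul_eq_mul] at hin
    refine (add_le_add hin (h₂n hne)).trans (le_of_eq ?_)
    ring
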